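/- Let $\mathbb F$ be a finite field with $q$ elements, $K_P=\mathbb F((t^{-1}))$, $\mathcal O_P=\mathbb F[[t^{-1}]]$, and let $\mathfrak t$ be the Bruhat–Tits tree of $K_P$: its vertices are the maximal orders of $\mathbb M_2(K_P)$, and two of them are neighbors when in some basis they are $\begin{pmatrix}\mathcal O_P&\mathcal O_P\\ \mathcal O_P&\mathcal O_P\end{pmatrix}$ and $\begin{pmatrix}\mathcal O_P&t^{-1}\mathcal O_P\\ t\,\mathcal O_P&\mathcal O_P\end{pmatrix}$. The ball $B_a^{[r]}\subseteq K_P$ of center $a$ and radius $|t^{-r}|$ is identified with the vertex $M\,\mathbb M_2(\mathcal O_P)M^{-1}$, $M=\begin{pmatrix}a&t^{-r}\\1&0\end{pmatrix}$. A ray of $\mathfrak t$ has visual limit $a\in K_P$ if its vertices are $B_a^{[r]},B_a^{[r+1]},\dots$ for some $r$, and $\infty$ if its vertices are $B_c^{[r]},B_c^{[r-1]},\dots$ for some $c$ and $r$. A vertex has type $n$ if it is in the $\mathrm{GL}_2(\mathbb F[t])$-orbit of $B_0^{[-n]}$. For $f\in\mathbb F[t]$ let $\Gamma_0(f)=\left\{\begin{pmatrix}a&b\\c&d\end{pmatrix}\in\mathrm{GL}_2(\mathbb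 F[t]) : f\mid c\right\}$, acting on $\mathfrak t$ by conjugation. The weighted reduced fine quotient $\Gamma_0(f)|\mathfrak t$ is the graph whose vertices are the orbits of vertices, two orbits $v,w$ being joined (by a half edge if $v=w$) when they have neighboring representatives, together with the weights $m_{v,w}$, the number of neighbors with class $w$ of any vertex with class $v$. Below, each graph is a finite graph with cusps attached. We write $v\,\overset{a\ \ b}{\text{—}}\,w$ for an edge with $m_{v,w}=a$, $m_{w,v}=b$. A cusp at $v$ is a ray $v=c_0,c_1,c_2,\dots$ with $m_{c_i,c_{i-1}}=q$ for $i\ge1$, $m_{c_i,c_{i+1}}=1$ for $i\geq 1$, and $m_{c_0,c_1}=1$ unless another value is given. Then $\Gamma_0(f)|\mathfrak t$ is isomorphic to the following graph, whose vertices $x_i$ have type $0$, and whose vertices $y_i$ have type $1$. 1. For $f=t$ and any $q$: one vertex $x_1$ and two cusps at $x_1$, with representatives $0$ and $\infty$, where $m_{c_0,c_1}$ equals $q$ for the first one and $1$ for the second one. 2. For $q=2$, $f=t(t+1)$: vertices $y_1,x_1,y_2,y_3,x_2,y_4$ and edges $y_1\overset{2\ \ 1}{\text{—}}x_1\overset{1\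 \ 2}{\text{—}}y_2$, $\ x_1\overset{1\ \ 1}{\text{—}}y_3\overset{1\ \ 2}{\text{—}}x_2\overset{1\ \ 2}{\text{—}}y_4$; cusps at $y_1,y_2,y_3,y_4$ with representatives $\frac1{t+1},\frac1t,0,\infty$. 3. For $q=2$, $f=(t+\alpha)^2$ with $\alpha\in\{0,1\}$: vertices and edges $y_1\overset{2\ \ 1}{\text{—}}x_1\overset{2\ \ 1}{\text{—}}y_2\overset{1\ \ 2}{\text{—}}x_2\overset{1\ \ 2}{\text{—}}y_3$; cusps at $y_1,y_2,y_3$ with representatives $\frac1{t+\alpha},0,\infty$. 4. For $q=2$, $f=t^2+t+1$: vertices and edges $x_1\overset{3\ \ 1}{\text{—}}y_1\overset{1\ \ 2}{\text{—}}x_2\overset{1\ \ 2}{\text{—}}y_2$; cusps at $y_1,y_2$ with representatives $0,\infty$. Here "with representatives" means that there is a fundamental region, that is, a lifting of the whole graph to $\mathfrak t$ which preserves adjacency, in which each cusp lifts to a ray whose visual limit is the given representative. -/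

import Mathlib

open Polynomial

/-! ### Weighted reduced fine graphs -/

/-- A reduced fine graph with weights. A reduced fine graph has no loops and no multiple edges, but it
may have half edges; it is determined by its (actual) vertices and its neighborhood relation `Adj`,
where `Adj v v` means that there is a half edge at `v`. -/
structure WeightedReducedGraph (V : Type*) where
  /-- the neighborhood relation -/
  Adj : V → V → Prop
  symm : ∀ v w, Adj v w → Adj w v
  /-- the weight of the edge from `v` to `w`, written close to `v` in pictures;
  it is zero when `v` and `w` are not neighbors -/
  weight : V → V → ℕ
  weight_eq_zero : ∀ v w, ¬ Adj v w → weight v w = 0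

/-- Isomorphisms of weighted reduced fine graphs. -/
structure WeightedReducedGraph.Iso {V W : Type*}
    (A : WeightedReducedGraph V) (B : WeightedReducedGraph W) extends V ≃ W where
  adj_iff : ∀ v w, B.Adj (toEquiv v) (toEquiv w) ↔ A.Adj v w
  weight_eq : ∀ v w, B.weight (toEquiv v) (toEquiv w) = A.weight v w

section Quotient

variable {V : Type*} (T : SimpleGraph V) (G : Type*) [Group G] [MulAction G V]

/-- The number of neighbors of `x` in `T` whose image in the quotient by `G` is `w`. -/
noncomputable def neighborCount (x : V) (w : MulAction.orbitRel.Quotient G V) : ℕ :=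
  Set.ncard {y : V | T.Adj x y ∧ (Quotient.mk _ y : MulAction.orbitRel.Quotient G V) = w}

theorem neighborCount_smul (hG : ∀ (g : G) (x y : V), T.Adj x y → T.Adj (g • x) (g • y))
    (g : G) (x : V) (w : MulAction.orbitRel.Quotient G V) :
    neighborCount T G (g • x) w = neighborCount T G x w := by
  have key : {y : V | T.Adj (g • x) y ∧ (Quotient.mk _ y : MulAction.orbitRel.Quotient G V) = w}
      = (fun y => g • y) ''
        {y : V | T.Adj x y ∧ (Quotient.mk _ y : MulAction.orbitRel.Quotient G V) = w} := by
    ext y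
    constructor
    · rintro ⟨h1, h2⟩
      refine ⟨g⁻¹ • y, ⟨?_, ?_⟩, by simp⟩
      · simpa using hG g⁻¹ _ _ h1
      · rw [← h2]
        exact Quotient.sound ⟨g⁻¹, rfl⟩
    · rintro ⟨z, ⟨h1, h2⟩, rfl⟩
      refine ⟨hG g _ _ h1, ?_⟩
      rw [← h2]
      exact Quotient.sound ⟨g, rfl⟩
  unfold neighborCount
  rw [key, Set.ncard_image_of_injective _ (MulAction.injective g)]

/-- The weighted reduced fine quotient of the graph `T` by `G`. Its vertices are the orbits of
vertices, two of them are neighbors when they have neighboring representatives, and the weight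
`m v w` is the number of neighbors, with image `w`, of one (any) vertex with image `v`. -/
noncomputable def weightedReducedFineQuotient
    (hG : ∀ (g : G) (x y : V), T.Adj x y → T.Adj (g • x) (g • y)) :
    WeightedReducedGraph (MulAction.orbitRel.Quotient G V) where
  Adj v w := ∃ x y : V, T.Adj x y ∧ Quotient.mk _ x = v ∧ Quotient.mk _ y = w
  symm := by
    rintro v w ⟨x, y, h, hx, hy⟩
    exact ⟨y, x, h.symm, hy, hx⟩
  weight v w := Quotient.lift (fun x => neighborCount T G x w)
    (by
      rintro a b ⟨g, rfl⟩
      exact neighborCount_smul T G hG g b w) v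
  weight_eq_zero := by
    intro v w h
    induction v using Quotient.inductionOn with
    | h x =>
      have : {y : V | T.Adj x y ∧ (Quotient.mk _ y : MulAction.orbitRel.Quotient G V) = w} = ∅ := by
        ext y
        simp only [Set.mem_ofPred_eq, Set.mem_empty_iff_false, iff_false]
        rintro ⟨h1, h2⟩
        exact h ⟨x, y, h1, rfl, h2⟩
      change neighborCount T G x w = 0
      unfold neighborCount
      rw [this, Set.ncard_empty]

end Quotient

/-! ### Finite weighted graphs with cusps attached -/

/-- Data for a finite weighted graph with `k` vertices and `l` cusps attached to it. -/
structure CuspDiagram (k l : ℕ) where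
  /-- the weights on the finite graph -/
  m : Fin k → Fin k → ℕ
  m_symm : ∀ i j, m i j ≠ 0 → m j i ≠ 0
  /-- the type of a vertex of the finite graph -/
  vtype : Fin k → ℕ
  /-- the initial vertex of a cusp -/
  start : Fin l → Fin k
  /-- the weight from the initial vertex of a cusp to the next vertex of the cusp -/
  out : Fin l → ℕ
  out_ne_zero : ∀ c, out c ≠ 0
  /-- the weight of the backward edges along the cusps; the forward edges have weight `1` -/
  q : ℕ
  q_ne_zero : q ≠ 0

namespace CuspDiagram

variable {k l : ℕ} (D : CuspDiagram k l)

/-- The vertices of the graph with the cusps attached: the vertices of the finite graph, and for each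
cusp `c` the vertices `(c, 0), (c, 1), …` that follow its initial vertex. -/
abbrev Vertex (_ : CuspDiagram k l) : Type := Fin k ⊕ (Fin l × ℕ)

/-- The `n`-th vertex of the cusp `c`, the initial vertex being number `0`. -/
def cuspVertex (c : Fin l) : ℕ → D.Vertex
  | 0 => Sum.inl (D.start c)
  | n + 1 => Sum.inr (c, n)

/-- The weights of the graph with the cusps attached. -/
def weight : D.Vertex → D.Vertex → ℕ
  | Sum.inl i, Sum.inl j => D.m i j
  | Sum.inl i, Sum.inr (c, n) => if i = D.start c ∧ n = 0 then D.out c else 0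
  | Sum.inr (c, n), Sum.inl i => if i = D.start c ∧ n = 0 then D.q else 0
  | Sum.inr (c, n), Sum.inr (c', n') =>
      if c = c' ∧ n' = n + 1 then 1 else if c = c' ∧ n = n' + 1 then D.q else 0

/-- The weighted reduced fine graph described by the diagram. -/
def graph : WeightedReducedGraph D.Vertex where
  Adj v w := D.weight v w ≠ 0
  symm := by
    have hm := D.m_symm
    have ho := D.out_ne_zero
    have hq := D.q_ne_zero
    rintro (i | ⟨c, n⟩) (j | ⟨c', n'⟩) h
    · exact hm i j h
    · simp only [weight] at h ⊢
      split_ifs at h ⊢ <;> simp_all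
    · simp only [weight] at h ⊢
      split_ifs at h ⊢ <;> simp_all
    · simp only [weight] at h ⊢
      split_ifs at h ⊢ <;> grind
  weight := D.weight
  weight_eq_zero _ _ h := not_not.mp h

end CuspDiagram

/-! ### The Bruhat–Tits tree at the infinite place of `F(t)` -/

namespace BruhatTits

open scoped LaurentSeries PowerSeries

variable (F : Type*) [Field F]

/-- The completion `F((t⁻¹))` of `F(t)` at the infinite place. The variable of the Laurent series
is the uniformizer `t⁻¹`, and the ring of integers is `F⟦X⟧`. -/
abbrev KP : Type _ := F⸨X⸩

/-- The element `t` of the completion. -/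
noncomputable def t : KP F := HahnSeries.single (-1 : ℤ) (1 : F)

/-- The inclusion of `F[t]` in the completion at infinity. -/
noncomputable def polyEmb : F[X] →+* KP F := (Polynomial.aeval (t F)).toRingHom

/-- The algebra of `2` by `2` matrices over the completion. -/
abbrev Mat : Type _ := Matrix (Fin 2) (Fin 2) (KP F)

variable {F}

/-- An order (of maximal rank) in the matrix algebra over the completion: a subalgebra over the ring
of integers that is finitely generated as a module and contains a basis of the matrix algebra. -/
def IsLocalOrder (D : Subalgebra F⟦X⟧ (Mat F)) : Prop :=
  (Subalgebra.toSubmodule D).FG ∧ Submodule.span (KP F) (D : Set (Mat F)) = ⊤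

variable (F) in
/-- The vertices of the Bruhat–Tits tree are the maximal orders of the matrix algebra. -/
def Vertex : Type _ := {D : Subalgebra F⟦X⟧ (Mat F) // Maximal IsLocalOrder D}

/-- Conjugation by an invertible matrix. -/
noncomputable def conj (g : GL (Fin 2) (KP F)) : Mat F →ₐ[F⟦X⟧] Mat F where
  toFun x := g.1 * x * (g⁻¹).1
  map_one' := by simp
  map_mul' x y := by
    have h : (g⁻¹).1 * g.1 = 1 := g.inv_mul
    calc g.1 * (x * y) * (g⁻¹).1 = g.1 * x * 1 * y * (g⁻¹).1 := by simp only [mul_assoc, one_mul]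
      _ = g.1 * x * ((g⁻¹).1 * g.1) * y * (g⁻¹).1 := by rw [h]
      _ = _ := by simp only [mul_assoc]
  map_zero' := by simp
  map_add' x y := by rw [mul_add, add_mul]
  commutes' r := by
    have h : g.1 * (g⁻¹).1 = 1 := g.mul_inv
    rw [← Algebra.commutes, mul_assoc, h, mul_one]

theorem conj_apply (g : GL (Fin 2) (KP F)) (x : Mat F) : conj g x = g.1 * x * (g⁻¹).1 := rfl

theorem conj_one : conj (1 : GL (Fin 2) (KP F)) = AlgHom.id _ _ := by
  ext1 x
  simp [conj_apply]

theorem conj_mul (g h : GL (Fin 2) (KP F)) : conj (g * h) = (conj g).comp (conj h) := by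
  ext1 x
  simp only [conj_apply, AlgHom.comp_apply, mul_inv_rev, Units.val_mul, mul_assoc]

theorem map_conj_mul (g h : GL (Fin 2) (KP F)) (D : Subalgebra F⟦X⟧ (Mat F)) :
    D.map (conj (g * h)) = (D.map (conj h)).map (conj g) := by
  rw [conj_mul, Subalgebra.map_map]

theorem map_conj_one (D : Subalgebra F⟦X⟧ (Mat F)) :
    D.map (conj (1 : GL (Fin 2) (KP F))) = D := by
  rw [conj_one, Subalgebra.map_id]

theorem isLocalOrder_map (g : GL (Fin 2) (KP F)) {D : Subalgebra F⟦X⟧ (Mat F)}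
    (hD : IsLocalOrder D) : IsLocalOrder (D.map (conj g)) := by
  refine ⟨?_, ?_⟩
  · have := hD.1.map (conj g).toLinearMap
    rwa [← Subalgebra.map_toSubmodule] at this
  · rw [eq_top_iff]
    intro x _
    have hx : (g⁻¹).1 * x * g.1 ∈ Submodule.span (KP F) (D : Set (Mat F)) := by
      rw [hD.2]; trivial
    let L : Mat F →ₗ[KP F] Mat F :=
      (LinearMap.mulLeft (KP F) g.1).comp (LinearMap.mulRight (KP F) (g⁻¹).1)
    have h2 : L ((g⁻¹).1 * x * g.1) = x := by
      have h : g.1 * (g⁻¹).1 = 1 := g.mul_inv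
      simp only [L, LinearMap.comp_apply, LinearMap.mulLeft_apply, LinearMap.mulRight_apply]
      calc g.1 * ((g⁻¹).1 * x * g.1 * (g⁻¹).1) = (g.1 * (g⁻¹).1) * x * (g.1 * (g⁻¹).1) := by
            simp only [mul_assoc]
        _ = x := by rw [h, one_mul, mul_one]
    have h3 : L ((g⁻¹).1 * x * g.1) ∈ (Submodule.span (KP F) (D : Set (Mat F))).map L :=
      Submodule.mem_map_of_mem hx
    rw [h2, Submodule.map_span] at h3
    refine Submodule.span_mono ?_ h3
    rintro _ ⟨y, hy, rfl⟩
    exact ⟨y, hy, by simp [L, conj_apply, mul_assoc]⟩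

theorem maximal_map (g : GL (Fin 2) (KP F)) {D : Subalgebra F⟦X⟧ (Mat F)}
    (hD : Maximal IsLocalOrder D) : Maximal IsLocalOrder (D.map (conj g)) := by
  refine ⟨isLocalOrder_map g hD.1, fun E hE hle => ?_⟩
  have h1 : D ≤ E.map (conj g⁻¹) := by
    have := Subalgebra.map_mono (f := conj g⁻¹) hle
    rwa [← map_conj_mul, inv_mul_cancel, map_conj_one] at this
  have h2 := Subalgebra.map_mono (f := conj g) (hD.2 (isLocalOrder_map g⁻¹ hE) h1)
  rwa [← map_conj_mul, mul_inv_cancel, map_conj_one] at h2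

/-- The action of `GL₂` on the vertices of the tree, by conjugation. -/
noncomputable instance : MulAction (GL (Fin 2) (KP F)) (Vertex F) where
  smul g D := ⟨D.1.map (conj g), maximal_map g D.2⟩
  one_smul D := Subtype.ext (map_conj_one D.1)
  mul_smul g h D := Subtype.ext (map_conj_mul g h D.1)

variable (F) in
/-- The order of matrices with coefficients in the ring of integers. -/
noncomputable def stdOrder : Subalgebra F⟦X⟧ (Mat F) :=
  ((Algebra.ofId F⟦X⟧ (KP F)).mapMatrix (m := Fin 2)).range

theorem mem_stdOrder {x : Mat F} :
    x ∈ stdOrder F ↔ ∀ i j, ∃ a : F⟦X⟧, algebraMap F⟦X⟧ (KP F) a = x i j := by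
  constructor
  · rintro ⟨y, rfl⟩ i j
    exact ⟨y i j, rfl⟩
  · intro h
    choose a ha using h
    exact ⟨Matrix.of a, by ext1 i j; exact ha i j⟩

theorem single_mem_stdOrder (i j : Fin 2) : Matrix.single i j (1 : KP F) ∈ stdOrder F := by
  rw [mem_stdOrder]
  intro k l
  by_cases h : i = k ∧ j = l
  · exact ⟨1, by simp [h]⟩
  · exact ⟨0, by simp [h]⟩

theorem isLocalOrder_stdOrder : IsLocalOrder (stdOrder F) := by
  refine ⟨?_, ?_⟩
  · have h : Subalgebra.toSubmodule (stdOrder F) =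
        LinearMap.range ((Algebra.ofId F⟦X⟧ (KP F)).mapMatrix (m := Fin 2)).toLinearMap := by
      ext; rfl
    rw [h]
    exact Submodule.fg_range _
  · rw [eq_top_iff]
    intro x _
    rw [Matrix.matrix_eq_sum_single x]
    refine Submodule.sum_mem _ fun i _ => Submodule.sum_mem _ fun j _ => ?_
    have : Matrix.single i j (x i j) = x i j • Matrix.single i j (1 : KP F) := by simp
    rw [this]
    exact Submodule.smul_mem _ _ (Submodule.subset_span (single_mem_stdOrder i j))

theorem maximal_stdOrder : Maximal IsLocalOrder (stdOrder F) := by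
  refine ⟨isLocalOrder_stdOrder, fun E hE hle x hx => ?_⟩
  rw [mem_stdOrder]
  intro i j
  have hmem : algebraMap (KP F) (Mat F) (x i j) ∈ E := by
    have h : algebraMap (KP F) (Mat F) (x i j) =
        ∑ k : Fin 2, Matrix.single k i (1 : KP F) * x * Matrix.single j k (1 : KP F) := by
      ext a b
      fin_cases a <;> fin_cases b <;>
        simp [Matrix.algebraMap_matrix_apply, Fin.sum_univ_two]
    rw [h]
    exact sum_mem fun k _ => mul_mem (mul_mem (hle (single_mem_stdOrder k i)) hx)
      (hle (single_mem_stdOrder j k))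
  have hint : IsIntegral F⟦X⟧ (algebraMap (KP F) (Mat F) (x i j)) :=
    IsIntegral.of_mem_of_fg E hE.1 _ hmem
  have hint2 : IsIntegral F⟦X⟧ (x i j) :=
    (isIntegral_algebraMap_iff (FaithfulSMul.algebraMap_injective (KP F) (Mat F))).mp hint
  exact IsIntegrallyClosed.isIntegral_iff.mp hint2

variable (F) in
/-- The vertex given by the order of matrices with coefficients in the ring of integers. -/
noncomputable def stdVertex : Vertex F := ⟨stdOrder F, maximal_stdOrder⟩

variable (F) in
/-- The matrix `diag(π, 1)`, where `π = t⁻¹`. The conjugate by it of the order of matrices with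
integral coefficients is `[[O, π O], [π⁻¹ O, O]]`. -/
noncomputable def stepMatrix : GL (Fin 2) (KP F) :=
  Matrix.GeneralLinearGroup.mkOfDetNeZero
    !![HahnSeries.single (1 : ℤ) (1 : F), 0; 0, 1] (by simp [Matrix.det_fin_two])

variable (F) in
/-- The matrix that exchanges the two basis vectors. -/
noncomputable def swapMatrix : GL (Fin 2) (KP F) :=
  Matrix.GeneralLinearGroup.mkOfDetNeZero !![0, 1; 1, 0] (by simp [Matrix.det_fin_two])

theorem swap_smul_stdVertex : swapMatrix F • stdVertex F = stdVertex F := by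
  have hinv : (swapMatrix F)⁻¹ = swapMatrix F := by
    rw [inv_eq_iff_mul_eq_one]
    ext i j
    fin_cases i <;> fin_cases j <;>
      simp [swapMatrix, Matrix.GeneralLinearGroup.mkOfDetNeZero]
  have hle : (stdOrder F).map (conj (swapMatrix F)) ≤ stdOrder F := by
    rintro _ ⟨x, hx, rfl⟩
    have hx' : x ∈ stdOrder F := hx
    rw [mem_stdOrder] at hx'
    change conj (swapMatrix F) x ∈ stdOrder F
    rw [mem_stdOrder, conj_apply, hinv]
    intro i j
    fin_cases i <;> fin_cases j
    · simpa [swapMatrix, Matrix.GeneralLinearGroup.mkOfDetNeZero, Matrix.mul_apply,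
        Fin.sum_univ_two, Matrix.vecMul, dotProduct] using hx' 1 1
    · simpa [swapMatrix, Matrix.GeneralLinearGroup.mkOfDetNeZero, Matrix.mul_apply,
        Fin.sum_univ_two, Matrix.vecMul, dotProduct] using hx' 1 0
    · simpa [swapMatrix, Matrix.GeneralLinearGroup.mkOfDetNeZero, Matrix.mul_apply,
        Fin.sum_univ_two, Matrix.vecMul, dotProduct] using hx' 0 1
    · simpa [swapMatrix, Matrix.GeneralLinearGroup.mkOfDetNeZero, Matrix.mul_apply,
        Fin.sum_univ_two, Matrix.vecMul, dotProduct] using hx' 0 0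
  exact Subtype.ext ((maximal_map (swapMatrix F) maximal_stdOrder).eq_of_le
    isLocalOrder_stdOrder hle)

theorem step_swap_step_smul :
    (stepMatrix F * swapMatrix F * stepMatrix F) • stdVertex F = stdVertex F := by
  have hc : ∀ x : Mat F,
      (stepMatrix F * swapMatrix F * stepMatrix F).1 * x =
        (swapMatrix F).1 * x * ((HahnSeries.single (1 : ℤ) (1 : F) : KP F) • (1 : Mat F)) := by
    intro x
    ext i j
    fin_cases i <;> fin_cases j <;>
      simp [stepMatrix, swapMatrix, Matrix.GeneralLinearGroup.mkOfDetNeZero, Matrix.mul_apply,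
        Fin.sum_univ_two, Matrix.vecMul, dotProduct, mul_comm]
  have hconj : conj (stepMatrix F * swapMatrix F * stepMatrix F) = conj (swapMatrix F) := by
    ext1 x
    set A := stepMatrix F * swapMatrix F * stepMatrix F with hA
    have h1 : A.1 * (A⁻¹).1 = 1 := A.mul_inv
    have h2 : ((swapMatrix F)⁻¹).1 * (swapMatrix F).1 = 1 := (swapMatrix F).inv_mul
    have h4 := hc (((swapMatrix F)⁻¹).1)
    have h5 : (swapMatrix F).1 * ((swapMatrix F)⁻¹).1 = 1 := (swapMatrix F).mul_inv
    rw [h5, one_mul] at h4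
    have h6 : A.1 = (HahnSeries.single (1 : ℤ) (1 : F) : KP F) • (swapMatrix F).1 := by
      calc A.1 = A.1 * (((swapMatrix F)⁻¹).1 * (swapMatrix F).1) := by rw [h2, mul_one]
        _ = A.1 * ((swapMatrix F)⁻¹).1 * (swapMatrix F).1 := by rw [mul_assoc]
        _ = _ := by rw [h4, smul_mul_assoc, one_mul]
    have h7 : ((swapMatrix F)⁻¹).1 = (HahnSeries.single (1 : ℤ) (1 : F) : KP F) • (A⁻¹).1 := by
      calc ((swapMatrix F)⁻¹).1 = ((swapMatrix F)⁻¹).1 * (A.1 * (A⁻¹).1) := by rw [h1, mul_one]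
        _ = ((HahnSeries.single (1 : ℤ) (1 : F) : KP F) •
            (((swapMatrix F)⁻¹).1 * (swapMatrix F).1)) * (A⁻¹).1 := by
          rw [h6]
          simp only [smul_mul_assoc, mul_smul_comm, mul_assoc]
        _ = _ := by rw [h2, smul_mul_assoc, one_mul]
    rw [conj_apply, conj_apply, h7, h6, smul_mul_assoc, smul_mul_assoc, mul_smul_comm]
  have h : (stepMatrix F * swapMatrix F * stepMatrix F) • stdVertex F =
      swapMatrix F • stdVertex F :=
    Subtype.ext (congrArg (fun c => (stdOrder F).map c) hconj)
  rw [h, swap_smul_stdVertex]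

theorem step_smul_ne : stepMatrix F • stdVertex F ≠ stdVertex F := by
  intro h
  have h1 : (stdOrder F).map (conj (stepMatrix F)) = stdOrder F := congrArg Subtype.val h
  have h2 : conj (stepMatrix F) (Matrix.single 1 0 1) ∈ stdOrder F := by
    rw [← h1]
    exact ⟨_, single_mem_stdOrder 1 0, rfl⟩
  set y := conj (stepMatrix F) (Matrix.single 1 0 1) with hy
  have h3 : y * (stepMatrix F).1 = (stepMatrix F).1 * Matrix.single 1 0 1 := by
    have h : ((stepMatrix F)⁻¹).1 * (stepMatrix F).1 = 1 := (stepMatrix F).inv_mul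
    rw [hy, conj_apply, mul_assoc, h, mul_one]
  obtain ⟨a, ha⟩ := mem_stdOrder.mp h2 1 0
  have h4 := congrFun (congrFun h3 1) 0
  simp [stepMatrix, Matrix.GeneralLinearGroup.mkOfDetNeZero, Matrix.mul_apply,
    Fin.sum_univ_two, ← ha] at h4
  rw [← HahnSeries.ofPowerSeries_X, ← map_mul, ← map_one (HahnSeries.ofPowerSeries ℤ F)] at h4
  have h5 := HahnSeries.ofPowerSeries_injective h4
  have h6 := congrArg (PowerSeries.coeff 0) h5
  simp at h6

variable (F) in
/-- The Bruhat–Tits tree: two maximal orders are neighbors when, in some basis, they are the orders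
`[[O, O], [O, O]]` and `[[O, π O], [π⁻¹ O, O]]`. -/
noncomputable def tree : SimpleGraph (Vertex F) where
  Adj x y := ∃ g : GL (Fin 2) (KP F), x = g • stdVertex F ∧ y = (g * stepMatrix F) • stdVertex F
  symm := ⟨by
    rintro x y ⟨g, rfl, rfl⟩
    refine ⟨g * stepMatrix F * swapMatrix F, ?_, ?_⟩
    · rw [mul_smul _ (swapMatrix F), swap_smul_stdVertex]
    · have h : g * stepMatrix F * swapMatrix F * stepMatrix F =
          g * (stepMatrix F * swapMatrix F * stepMatrix F) := by simp only [mul_assoc]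
      rw [h, mul_smul g, step_swap_step_smul]⟩
  loopless := ⟨by
    rintro x ⟨g, rfl, h⟩
    rw [mul_smul] at h
    exact step_smul_ne (MulAction.injective g h).symm⟩

theorem tree_adj_smul (g : GL (Fin 2) (KP F)) (x y : Vertex F) (h : (tree F).Adj x y) :
    (tree F).Adj (g • x) (g • y) := by
  obtain ⟨h, rfl, rfl⟩ := h
  exact ⟨g * h, by rw [mul_smul], by rw [mul_assoc, mul_smul g]⟩

/-- The vertex of the closed ball with center `a` and radius `|t^(-r)|`, that is, the maximal order
`M · M₂(O) · M⁻¹` for `M = [[a, t^(-r)], [1, 0]]`. -/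
noncomputable def ballVertex (a : KP F) (r : ℤ) : Vertex F :=
  Matrix.GeneralLinearGroup.mkOfDetNeZero
    !![a, HahnSeries.single r (1 : F); 1, 0] (by simp [Matrix.det_fin_two]) • stdVertex F

/-- A ray `x 0, x 1, …` in the tree has the visual limit `∞` when its vertices correspond to an
increasing sequence of balls with radii `|t^(-r)|, |t^(-r+1)|, …`, and the visual limit `a` in the
completion when they correspond to a decreasing sequence of balls with center `a` and radii
`|t^(-r)|, |t^(-r-1)|, …`. -/
def HasVisualLimit (x : ℕ → Vertex F) : OnePoint (KP F) → Prop
  | none => ∃ (c : KP F) (r : ℤ), ∀ n : ℕ, x n = ballVertex c (r - n)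
  | some a => ∃ r : ℤ, ∀ n : ℕ, x n = ballVertex a (r + n)

/-- The vertex `x` has type `n` when it is in the orbit of the ball with center `0` and radius
`|t ^ n|` under `GL₂(F[t])`. -/
def HasType (x : Vertex F) (n : ℕ) : Prop :=
  ∃ g : GL (Fin 2) F[X], Matrix.GeneralLinearGroup.map (polyEmb F) g • x = ballVertex 0 (-n)

/-- The Hecke congruence subgroup `Γ₀(f)` of `GL₂(F[t])`. -/
def Gamma0 (f : F[X]) : Subgroup (GL (Fin 2) F[X]) where
  carrier := {g | f ∣ g.1 1 0}
  one_mem' := by simp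
  mul_mem' := by
    intro g h hg hh
    simp only [Set.mem_ofPred_eq, Units.val_mul, Matrix.mul_apply, Fin.sum_univ_two] at hg hh ⊢
    exact dvd_add (hg.mul_right _) (hh.mul_left _)
  inv_mem' := by
    intro g hg
    simp only [Set.mem_ofPred_eq] at hg ⊢
    rw [Matrix.coe_units_inv, Matrix.inv_def, Matrix.adjugate_fin_two]
    simpa using hg

/-- The group `Γ₀(f)`, seen inside the general linear group over the completion. -/
noncomputable abbrev Gamma0KP (f : F[X]) : Subgroup (GL (Fin 2) (KP F)) :=
  (Gamma0 f).map (Matrix.GeneralLinearGroup.map (polyEmb F))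

/-- The weighted reduced fine quotient of the Bruhat–Tits tree by `Γ₀(f)`. -/
noncomputable def heckeQuotient (f : F[X]) :
    WeightedReducedGraph (MulAction.orbitRel.Quotient (Gamma0KP f) (Vertex F)) :=
  weightedReducedFineQuotient (tree F) (Gamma0KP f) fun g x y h => tree_adj_smul g.1 x y h

/-- The diagram `D` describes the weighted reduced fine quotient `Γ₀(f)|𝔱`, the vertices have the types
that are given in `D`, and the points `lim c` are representatives of the cusps: there is a
fundamental region, which is a lifting of the graph to the tree, in which every cusp `c` lifts to a
ray with visual limit `lim c`. -/
def IsQuotientDiagram {k l : ℕ} (f : F[X]) (D : CuspDiagram k l) (lim : Fin l → OnePoint (KP F)) :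
    Prop :=
  ∃ (φ : D.graph.Iso (heckeQuotient f)) (σ : D.Vertex → Vertex F),
    (∀ v, Quotient.mk _ (σ v) = φ.toEquiv v) ∧
    (∀ v w, D.graph.Adj v w → (tree F).Adj (σ v) (σ w)) ∧
    (∀ i, HasType (σ (Sum.inl i)) (D.vtype i)) ∧
    (∀ c, HasVisualLimit (fun n => σ (D.cuspVertex c n)) (lim c))

end BruhatTits

/-! ### The table -/

/-- The diagram for `f = t`. The cusps are those of `0` and `∞`. -/
def diagramLinear (q : ℕ) (hq : q ≠ 0) : CuspDiagram 1 2 where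
  m := ![![0]]
  m_symm := by decide
  vtype := ![0]
  start := ![0, 0]
  out := ![q, 1]
  out_ne_zero c := by fin_cases c <;> simp [hq]
  q := q
  q_ne_zero := hq

/-- The diagram for `f = t (t + 1)` and `q = 2`. The vertices `0, 1, 2` are on the upper line of the
picture, and `3, 4, 5` on the lower line, from left to right. The cusps are those of `1 / (t + 1)`,
`1 / t`, `0` and `∞`. -/
def diagramSplit : CuspDiagram 6 4 where
  m := ![![0, 2, 0, 0, 0, 0],
         ![1, 0, 1, 1, 0, 0],
         ![0, 2, 0, 0, 0, 0],
         ![0, 1, 0, 0, 1, 0],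
         ![0, 0, 0, 2, 0, 1],
         ![0, 0, 0, 0, 2, 0]]
  m_symm := by decide
  vtype := ![1, 0, 1, 1, 0, 1]
  start := ![0, 2, 3, 5]
  out := ![1, 1, 1, 1]
  out_ne_zero := by decide
  q := 2
  q_ne_zero := by decide

/-- The diagram for `f = t ^ 2` and `q = 2`. The vertices are numbered from left to right. The cusps
are those of `1 / t`, `0` and `∞`. -/
def diagramSquare : CuspDiagram 5 3 where
  m := ![![0, 2, 0, 0, 0],
         ![1, 0, 2, 0, 0],
         ![0, 1, 0, 1, 0],
         ![0, 0, 2, 0, 1],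
         ![0, 0, 0, 2, 0]]
  m_symm := by decide
  vtype := ![1, 0, 1, 0, 1]
  start := ![0, 2, 4]
  out := ![1, 1, 1]
  out_ne_zero := by decide
  q := 2
  q_ne_zero := by decide

/-- The diagram for `f = t ^ 2 + t + 1` and `q = 2`. The vertices are numbered from left to right. The
cusps are those of `0` and `∞`. -/
def diagramInert : CuspDiagram 4 2 where
  m := ![![0, 3, 0, 0],
         ![1, 0, 1, 0],
         ![0, 2, 0, 1],
         ![0, 0, 2, 0]]
  m_symm := by decide
  vtype := ![0, 1, 0, 1]
  start := ![1, 3]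
  out := ![1, 1]
  out_ne_zero := by decide
  q := 2
  q_ne_zero := by decide

/-! Call `stage γ n` the image under γ in GL₂(F[t]) of the ball of center 0 and radius |tⁿ|. The
stabilizer of that ball in GL₂(F[t]) is GL₂(F) for n = 0; for n ≥ 1 it consists of the upper
triangular matrices with constant diagonal and corner of degree at most n
(`emb_smul_ballVertex_eq_iff`). So the Γ₀(f)-classes of stages of level n are double cosets, and a
coset Γ₀(f)γ only remembers the second row of γ modulo f up to units, a point of the projective line
over F[t]/(f). Two stages are therefore equivalent when their levels agree and their rows are
related by the image of the stabilizer modulo f (`ResidueModel.smul_stage_iff`).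

When every class modulo f has a representative of degree at most one, that image is the same for all
n ≥ 1. From level 1 on the classes no longer change, which produces the cusps; only finitely many
classes at levels 0 and 1 are left to examine.

The q + 1 neighbors of a stage are again stages with explicit rows: one at the next level, the
others one level down (or at level 1, from level 0). Hence representatives that are pairwise
inequivalent and whose neighbors are all equivalent to representatives exhaust the quotient, because
the tree is connected (`exists_iso_weightedReducedFineQuotient`, `tree_preconnected`); acyclicity
plays no role. `ResidueModel.isQuotientDiagram` condenses this into a finite list of conditions. For
f = t the residue ring is F and they are checked by hand; for the quadratic f over two elements it
has four elements and they are checked by exhaustion. The visual limits come from Möbius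
transformations: the identity, z ↦ 1/z and z ↦ z/(pz + 1) send ∞ to ∞, 0 and 1/p. -/

namespace BruhatTits

open scoped LaurentSeries PowerSeries

/-! ### Valuations in the completion, expressed by integrality after scaling by powers of the
uniformizer. -/

section Integers

variable {F : Type*} [Field F]

variable (F) in
/-- The ring of integers of the completion, as a subring. -/
noncomputable def integers : Subring (KP F) := (algebraMap F⟦X⟧ (KP F)).range

variable (F) in
/-- The power `π ^ k = t ^ (-k)` of the uniformizer. -/
noncomputable def unif (k : ℤ) : KP F := HahnSeries.single k 1

theorem algebraMap_mem_integers (a : F⟦X⟧) : algebraMap F⟦X⟧ (KP F) a ∈ integers F := ⟨a, rfl⟩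

theorem unif_add (k l : ℤ) : unif F (k + l) = unif F k * unif F l := by
  simp [unif, HahnSeries.single_mul_single]

theorem unif_zero : unif F 0 = 1 := rfl

theorem unif_ne_zero (k : ℤ) : unif F k ≠ 0 := by
  simp [unif]

theorem unif_neg (k : ℤ) : unif F (-k) = (unif F k)⁻¹ := by
  apply eq_inv_of_mul_eq_one_left
  rw [← unif_add, neg_add_cancel, unif_zero]

theorem t_eq_unif : t F = unif F (-1) := rfl

theorem t_pow (n : ℕ) : t F ^ n = unif F (-n) := by
  induction n with
  | zero => simp [unif_zero]
  | succ n ih => rw [pow_succ, ih, t_eq_unif, ← unif_add]; congr 1; push_cast; ring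

theorem mem_integers_iff_coeff {x : KP F} : x ∈ integers F ↔ ∀ n < 0, x.coeff n = 0 := by
  constructor
  · rintro ⟨a, rfl⟩ n hn
    rw [LaurentSeries.coe_algebraMap, PowerSeries.coeff_coe, if_pos hn]
  · intro h
    refine ⟨PowerSeries.mk fun n => x.coeff n, ?_⟩
    ext n
    rw [LaurentSeries.coe_algebraMap, PowerSeries.coeff_coe]
    split_ifs with hn
    · exact (h n hn).symm
    · rw [PowerSeries.coeff_mk]
      congr 1
      omega

theorem coeff_mul_unif (x : KP F) (k n : ℤ) : (x * unif F k).coeff n = x.coeff (n - k) := by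
  simp [unif, HahnSeries.coeff_mul_single]

theorem mul_unif_mem_integers {x : KP F} {k : ℤ} :
    x * unif F k ∈ integers F ↔ ∀ n < -k, x.coeff n = 0 := by
  rw [mem_integers_iff_coeff]
  simp only [coeff_mul_unif]
  constructor
  · intro h n hn
    simpa using h (n + k) (by omega)
  · intro h n hn
    exact h _ (by omega)

theorem unif_mem_integers {k : ℤ} : unif F k ∈ integers F ↔ 0 ≤ k := by
  rw [← one_mul (unif F k), mul_unif_mem_integers]
  constructor
  · intro h
    by_contra hk
    simpa using h 0 (by omega)
  · intro hk n hn
    exact HahnSeries.coeff_single_of_ne (by omega)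

theorem mul_unif_mem_of_le {x : KP F} {k l : ℤ} (h : x * unif F k ∈ integers F) (hkl : k ≤ l) :
    x * unif F l ∈ integers F := by
  rw [mul_unif_mem_integers] at h ⊢
  exact fun n hn => h n (by omega)

theorem exists_mul_unif_mem (x : KP F) : ∃ k : ℕ, x * unif F k ∈ integers F := by
  refine ⟨x.order.natAbs, ?_⟩
  rw [mul_unif_mem_integers]
  exact fun n hn => HahnSeries.coeff_eq_zero_of_lt_order (by omega)

theorem div_mem_or_div_mem (x y : KP F) : (∃ a ∈ integers F, x = a * y) ∨ ∃ a ∈ integers F, y = a * x := by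
  rcases eq_or_ne x 0 with rfl | hx
  · exact Or.inl ⟨0, zero_mem _, by simp⟩
  rcases eq_or_ne y 0 with rfl | hy
  · exact Or.inr ⟨0, zero_mem _, by simp⟩
  rcases ValuationRing.isInteger_or_isInteger F⟦X⟧ (x / y) with h | h
  · exact Or.inl ⟨x / y, h, by field_simp⟩
  · refine Or.inr ⟨(x / y)⁻¹, h, by field_simp⟩

theorem exists_unit_mul_unif {x : KP F} (hx : x ≠ 0) :
    ∃ (k : ℤ) (u : F⟦X⟧), IsUnit u ∧ x = unif F k * algebraMap F⟦X⟧ (KP F) u := by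
  refine ⟨x.order, x.powerSeriesPart, ?_, ?_⟩
  · rw [PowerSeries.isUnit_iff_constantCoeff, ← PowerSeries.coeff_zero_eq_constantCoeff_apply]
    rw [LaurentSeries.powerSeriesPart_coeff]
    simpa using hx
  · rw [LaurentSeries.coe_algebraMap]
    exact (LaurentSeries.single_order_mul_powerSeriesPart x).symm

/-- The valuation v of x is an integer with 2v ≥ -k ≥ -2l - 1, which forces v ≥ -l. The slack of one
is what later separates neighboring balls by a condition on squares alone. -/
theorem mul_unif_mem_of_sq {x : KP F} {k : ℤ} (h : x * x * unif F k ∈ integers F) {l : ℤ}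
    (hl : k ≤ 2 * l + 1) : x * unif F l ∈ integers F := by
  rcases eq_or_ne x 0 with rfl | hx
  · simp [zero_mem]
  rw [mul_unif_mem_integers] at h ⊢
  have h1 : -k ≤ (x * x).order := by
    by_contra! hc
    exact mul_ne_zero hx hx (HahnSeries.coeff_order_eq_zero.mp (h _ hc))
  rw [HahnSeries.order_mul hx hx] at h1
  exact fun n hn => HahnSeries.coeff_eq_zero_of_lt_order (by omega)

/-- Subtracting the leading term raises the valuation by one; the constants b index the sub-balls of
a ball. -/
theorem exists_const_sub_mem {x : KP F} {k : ℤ} (h : x * unif F k ∈ integers F) :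
    ∃ b : F, (x - HahnSeries.C b * unif F (-k)) * unif F (k - 1) ∈ integers F := by
  refine ⟨x.coeff (-k), ?_⟩
  rw [mul_unif_mem_integers] at h ⊢
  intro n hn
  rw [HahnSeries.coeff_sub, coeff_mul_unif, HahnSeries.C_apply]
  rcases eq_or_ne n (-k) with rfl | hne
  · simp
  · rw [h n (by omega), HahnSeries.coeff_single_of_ne (by omega), sub_zero]

theorem const_mem_integers (b : F) : (HahnSeries.C b : KP F) ∈ integers F := by
  rw [mem_integers_iff_coeff]
  intro n hn
  rw [HahnSeries.C_apply]
  exact HahnSeries.coeff_single_of_ne (by omega)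

theorem const_mul_unif_mem {b : F} {k : ℤ} (h : HahnSeries.C b * unif F k ∈ integers F)
    (hk : k < 0) : b = 0 := by
  rw [mul_unif_mem_integers] at h
  simpa using h 0 (by omega)

end Integers

/-! ### Polynomials in the completion: degree as minus the valuation. -/

section Polynomials

variable {F : Type*} [Field F]

theorem polyEmb_X : polyEmb F X = t F := by simp [polyEmb]

theorem polyEmb_C (a : F) : polyEmb F (C a) = HahnSeries.C a := by
  simp only [polyEmb, AlgHom.toRingHom_eq_coe, RingHom.coe_coe, aeval_C]
  rw [HahnSeries.algebraMap_apply']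
  simp

theorem polyEmb_coeff (p : F[X]) (n : ℕ) : (polyEmb F p).coeff (-n) = p.coeff n := by
  induction p using Polynomial.induction_on' with
  | add p q hp hq => simp [hp, hq]
  | monomial m a =>
    rw [← C_mul_X_pow_eq_monomial, map_mul, map_pow, polyEmb_C, polyEmb_X, t_pow, coeff_mul_unif,
      coeff_C_mul_X_pow, HahnSeries.C_apply, HahnSeries.coeff_single]
    congr 1
    simp only [eq_iff_iff]
    omega

theorem polyEmb_coeff_of_pos (p : F[X]) {n : ℤ} (hn : 0 < n) : (polyEmb F p).coeff n = 0 := by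
  induction p using Polynomial.induction_on' with
  | add p q hp hq => simp [hp, hq]
  | monomial m a =>
    rw [← C_mul_X_pow_eq_monomial, map_mul, map_pow, polyEmb_C, polyEmb_X, t_pow, coeff_mul_unif,
      HahnSeries.C_apply]
    exact HahnSeries.coeff_single_of_ne (by omega)

theorem polyEmb_mul_unif_mem {p : F[X]} {k : ℤ} :
    polyEmb F p * unif F k ∈ integers F ↔ p = 0 ∨ (p.natDegree : ℤ) ≤ k := by
  rw [mul_unif_mem_integers]
  constructor
  · intro h
    by_contra! hc
    have := h (-p.natDegree) (by omega)
    rw [polyEmb_coeff, coeff_natDegree, leadingCoeff_eq_zero] at this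
    exact hc.1 this
  · rintro (rfl | h) n hn
    · simp
    · rcases lt_or_ge 0 n with hn' | hn'
      · exact polyEmb_coeff_of_pos p hn'
      · obtain ⟨m, rfl⟩ : ∃ m : ℕ, n = -m := ⟨n.natAbs, by omega⟩
        rw [polyEmb_coeff]
        exact coeff_eq_zero_of_natDegree_lt (by omega)

theorem polyEmb_sq_mul_unif_mem {p : F[X]} {k : ℤ} :
    polyEmb F p * polyEmb F p * unif F k ∈ integers F ↔ p = 0 ∨ 2 * (p.natDegree : ℤ) ≤ k := by
  rw [← map_mul, polyEmb_mul_unif_mem]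
  rcases eq_or_ne p 0 with rfl | hp
  · simp
  · rw [natDegree_mul hp hp]
    simp [hp, two_mul]

theorem polyEmb_injective : Function.Injective (polyEmb F) := by
  rw [injective_iff_map_eq_zero]
  intro p hp
  ext n
  rw [← polyEmb_coeff, hp]
  simp

end Polynomials

/-! ### Maximal orders as conjugates of the standard one, and how to compare them. -/

section Vertices

variable {F : Type*} [Field F]

theorem smul_val (g : GL (Fin 2) (KP F)) (x : Vertex F) : (g • x).1 = x.1.map (conj g) := rfl

theorem mem_smul_stdVertex {g : GL (Fin 2) (KP F)} {e : Mat F} :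
    e ∈ (g • stdVertex F).1 ↔ (g⁻¹).1 * e * g.1 ∈ stdOrder F := by
  rw [smul_val, Subalgebra.mem_map]
  have h1 : g.1 * (g⁻¹).1 = 1 := g.mul_inv
  have h2 : (g⁻¹).1 * g.1 = 1 := g.inv_mul
  constructor
  · rintro ⟨x, hx, rfl⟩
    have : (g⁻¹).1 * conj g x * g.1 = x := by
      rw [conj_apply]
      calc _ = ((g⁻¹).1 * g.1) * x * ((g⁻¹).1 * g.1) := by simp only [mul_assoc]
        _ = x := by rw [h2, one_mul, mul_one]
    rw [this]
    exact hx
  · intro h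
    refine ⟨_, h, ?_⟩
    rw [conj_apply]
    calc _ = (g.1 * (g⁻¹).1) * e * (g.1 * (g⁻¹).1) := by simp only [mul_assoc]
      _ = e := by rw [h1, one_mul, mul_one]

theorem mem_stdOrder_iff {x : Mat F} : x ∈ stdOrder F ↔ ∀ i j, x i j ∈ integers F := mem_stdOrder

theorem vertex_eq_of_le {x y : Vertex F} (h : ∀ e ∈ x.1, e ∈ y.1) : x = y :=
  Subtype.ext (x.2.eq_of_le y.2.1 h)

theorem coe_inv_eq (g : GL (Fin 2) (KP F)) : (g⁻¹).1 = g.1.det⁻¹ • g.1.adjugate := by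
  rw [Matrix.coe_units_inv, Matrix.inv_def, Ring.inverse_eq_inv']

theorem det_ne_zero (g : GL (Fin 2) (KP F)) : g.1.det ≠ 0 :=
  ((Matrix.isUnit_iff_isUnit_det _).mp g.isUnit).ne_zero

/-- The adjugate of a 2 by 2 matrix has the same entries up to order and sign. -/
theorem adjugate_products (P : Mat F) (s : Subring (KP F)) (d : KP F) :
    (∀ i j k l, d * (P i j * P.adjugate k l) ∈ s) ↔ ∀ i j k l, d * (P i j * P k l) ∈ s := by
  have hneg : ∀ i j k l, d * (P i j * -P k l) ∈ s ↔ d * (P i j * P k l) ∈ s := by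
    intro i j k l
    rw [mul_neg, mul_neg]
    exact neg_mem_iff
  refine forall_congr' fun i => forall_congr' fun j => ?_
  simp only [Matrix.adjugate_fin_two, Fin.forall_fin_two, Matrix.of_apply, Matrix.cons_val_zero,
    Matrix.cons_val_one, hneg]
  tauto

/-- Comparison of the vertex `h • stdVertex` with the multiples of the vertex `g • stdVertex` in
terms of the matrix coefficients. -/
theorem smul_mem_smul_stdVertex_iff (g h : GL (Fin 2) (KP F)) (c d : KP F)
    (hd : d * (g.1.det * h.1.det) = c) :
    (∀ e ∈ (h • stdVertex F).1, c • e ∈ (g • stdVertex F).1) ↔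
      ∀ i j k l, d * ((g.1.adjugate * h.1) i j * (g.1.adjugate * h.1) k l) ∈ integers F := by
  set P := g.1.adjugate * h.1 with hP
  have key : ∀ x : Mat F, (g⁻¹).1 * (c • (h.1 * x * (h⁻¹).1)) * g.1 = d • (P * x * P.adjugate) := by
    intro x
    rw [coe_inv_eq, coe_inv_eq, hP, Matrix.adjugate_mul_distrib,
      Matrix.adjugate_adjugate g.1 (by simp)]
    simp only [Fintype.card_fin, Nat.sub_self, pow_zero, one_smul, smul_mul_assoc, mul_smul_comm,
      smul_smul, mul_assoc]
    congr 1
    have := det_ne_zero g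
    have := det_ne_zero h
    rw [← hd]
    field_simp
  have hstep : (∀ e ∈ (h • stdVertex F).1, c • e ∈ (g • stdVertex F).1) ↔
      ∀ x ∈ stdOrder F, d • (P * x * P.adjugate) ∈ stdOrder F := by
    constructor
    · intro H x hx
      rw [← key, ← mem_smul_stdVertex]
      exact H _ ⟨x, hx, rfl⟩
    · rintro H _ ⟨x, hx, rfl⟩
      rw [mem_smul_stdVertex]
      have := H x hx
      rw [← key] at this
      exact this
  rw [hstep, ← adjugate_products P (integers F)]
  constructor
  · intro H i j k l
    -- The matrix units span the standard order, and testing on one of them isolates a single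
    -- product of entries.
    have := mem_stdOrder_iff.mp (H _ (single_mem_stdOrder j k)) i l
    rw [Matrix.smul_apply, Matrix.mul_apply] at this
    simpa [Matrix.mul_single_apply_same, Matrix.mul_apply, Matrix.single_apply, ite_and] using this
  · intro H x hx
    rw [mem_stdOrder_iff] at hx ⊢
    intro i j
    rw [Matrix.smul_apply, Matrix.mul_apply, smul_eq_mul, Finset.mul_sum]
    refine sum_mem fun k _ => ?_
    rw [Matrix.mul_apply, Finset.sum_mul, Finset.mul_sum]
    refine sum_mem fun l _ => ?_
    have := mul_mem (H i l k j) (hx l k)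
    convert this using 1
    ring

/-- One inclusion between maximal orders is already an equality, so no symmetric condition is
needed. -/
theorem smul_stdVertex_eq_iff (g h : GL (Fin 2) (KP F)) (d : KP F)
    (hd : d * (g.1.det * h.1.det) = 1) :
    h • stdVertex F = g • stdVertex F ↔
      ∀ i j k l, d * ((g.1.adjugate * h.1) i j * (g.1.adjugate * h.1) k l) ∈ integers F := by
  rw [← smul_mem_smul_stdVertex_iff g h 1 d hd]
  constructor
  · intro H e he
    rw [one_smul, ← H]
    exact he
  · intro H
    refine vertex_eq_of_le fun e he => ?_
    simpa using H e he

/-- The matrix diag(π, 1) is integral with determinant π. This inclusion, together with `x ≠ y`, is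
enough to determine all neighbors of a ball. -/
theorem unif_smul_mem_of_adj {x y : Vertex F} (h : (tree F).Adj x y) :
    ∀ e ∈ y.1, unif F 1 • e ∈ x.1 := by
  obtain ⟨g, rfl, rfl⟩ := h
  have h0 : ∀ e ∈ (stepMatrix F • stdVertex F).1,
      unif F 1 • e ∈ ((1 : GL (Fin 2) (KP F)) • stdVertex F).1 := by
    have hdet : (stepMatrix F).1.det = unif F 1 := by
      simp [stepMatrix, Matrix.GeneralLinearGroup.mkOfDetNeZero, Matrix.det_fin_two, unif]
    rw [smul_mem_smul_stdVertex_iff _ _ _ 1 (by rw [hdet]; simp)]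
    have hent : ∀ i j, ((stepMatrix F).1 i j) ∈ integers F := by
      have : (HahnSeries.single (1 : ℤ) (1 : F) : KP F) ∈ integers F :=
        unif_mem_integers.mpr zero_le_one
      simp [Fin.forall_fin_two, stepMatrix, Matrix.GeneralLinearGroup.mkOfDetNeZero, this,
        zero_mem, one_mem]
    intro i j k l
    simp only [Units.val_one, Matrix.adjugate_one, one_mul]
    exact mul_mem (hent _ _) (hent _ _)
  rw [one_smul] at h0
  intro e he
  rw [mul_smul, smul_val] at he
  obtain ⟨e', he', rfl⟩ := he
  refine ⟨unif F 1 • e', h0 e' he', ?_⟩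
  change conj g (unif F 1 • e') = unif F 1 • conj g e'
  rw [conj_apply, conj_apply, mul_smul_comm, smul_mul_assoc]

/-- Every maximal order is conjugate to the order of matrices with integral coefficients. -/
theorem exists_smul_stdVertex (x : Vertex F) : ∃ g : GL (Fin 2) (KP F), g • stdVertex F = x := by
  obtain ⟨D, hD⟩ := x
  let ev (j : Fin 2) : Mat F →ₗ[F⟦X⟧] (Fin 2 → KP F) :=
    { toFun := fun x i => x i j
      map_add' := fun _ _ => rfl
      map_smul' := fun _ _ => rfl }
  -- The lattice generated by the columns of elements of `D` is stable under `D`. It is free of rank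
  -- two, so `D` lies in its endomorphism ring, a conjugate of the standard order, and maximality
  -- gives equality.
  let M : Submodule F⟦X⟧ (Fin 2 → KP F) :=
    (Subalgebra.toSubmodule D).map (ev 0) ⊔ (Subalgebra.toSubmodule D).map (ev 1)
  have hev : ∀ j, ∀ x ∈ D, ev j x ∈ M := by
    intro j x hx
    fin_cases j
    · exact Submodule.mem_sup_left ⟨x, hx, rfl⟩
    · exact Submodule.mem_sup_right ⟨x, hx, rfl⟩
  have hmul : ∀ x ∈ D, ∀ v ∈ M, x.mulVec v ∈ M := by
    intro x hx v hv
    obtain ⟨_, ⟨y, hy, rfl⟩, _, ⟨z, hz, rfl⟩, rfl⟩ := Submodule.mem_sup.mp hv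
    rw [Matrix.mulVec_add]
    exact add_mem (hev 0 (x * y) (mul_mem hx hy)) (hev 1 (x * z) (mul_mem hx hz))
  have hlat : M.IsLattice (KP F) := by
    refine ⟨(hD.1.1.map _).sup (hD.1.1.map _), ?_⟩
    rw [eq_top_iff]
    intro v _
    have : v = ∑ j, v j • ev j 1 := by
      funext i
      have hone : ∀ i j, ev j 1 i = if i = j then 1 else 0 := fun i j => Matrix.one_apply
      revert i
      simp [hone]
    rw [this]
    exact sum_mem fun j _ => Submodule.smul_mem _ _ (Submodule.subset_span (hev j 1 (one_mem D)))
  have hrank : Module.finrank F⟦X⟧ M = 2 := by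
    rw [Submodule.IsLattice.finrank_of_pi (KP F) M, Fintype.card_fin]
  have hfree : Module.Free F⟦X⟧ M := Submodule.IsLattice.free (K := KP F) M
  have hfin : Module.Finite F⟦X⟧ M := Submodule.IsLattice.finite (A := KP F) M
  let b : Module.Basis (Fin 2) F⟦X⟧ M := Module.finBasisOfFinrankEq F⟦X⟧ M hrank
  let B := b.extendOfIsLattice (KP F)
  let m : Mat F := (Pi.basisFun (KP F) (Fin 2)).toMatrix B
  have hm : IsUnit m := by
    have := Module.Basis.toMatrix_mul_toMatrix_flip (Pi.basisFun (KP F) (Fin 2)) B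
    exact IsUnit.of_mul_eq_one _ this
  have hmb : ∀ i j, m i j = (b j).1 i := by
    intro i j
    simp [m, B, Module.Basis.toMatrix_apply]
  obtain ⟨g, hg⟩ := hm
  refine ⟨g, (vertex_eq_of_le fun e he => ?_).symm⟩
  rw [mem_smul_stdVertex]
  have hcol : ∀ j, ∃ a : Fin 2 → F⟦X⟧, ∀ i, (e * m) i j = ∑ k, m i k * algebraMap _ (KP F) (a k) := by
    intro j
    let w : M := ⟨e.mulVec (b j).1, hmul e he _ (b j).2⟩
    refine ⟨b.repr w, fun i => ?_⟩
    have := congrArg (fun u : M => u.1 i) (b.sum_repr w)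
    simp only [Submodule.coe_sum, Submodule.coe_smul, Finset.sum_apply, Pi.smul_apply, w] at this
    rw [Matrix.mul_apply]
    simp only [hmb]
    refine Eq.trans this.symm (Finset.sum_congr rfl fun k _ => ?_)
    rw [Algebra.smul_def, mul_comm]
  choose a ha using hcol
  have : (g⁻¹).1 * e * g.1 = (Matrix.of fun k j => algebraMap _ (KP F) (a j k)) := by
    have h2 : (g⁻¹).1 * g.1 = 1 := g.inv_mul
    have h3 : e * g.1 = g.1 * (Matrix.of fun k j => algebraMap _ (KP F) (a j k)) := by
      ext i j
      rw [hg, ha, Matrix.mul_apply]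
      rfl
    rw [mul_assoc, h3, ← mul_assoc, h2, one_mul]
  rw [this, mem_stdOrder_iff]
  intro i j
  exact algebraMap_mem_integers _

end Vertices

/-! ### Vertices as balls, their neighbors, and connectedness. -/

section Balls

variable {F : Type*} [Field F]

/-- The matrix that defines the vertex of a ball. -/
noncomputable def ballMat (a : KP F) (r : ℤ) : GL (Fin 2) (KP F) :=
  Matrix.GeneralLinearGroup.mkOfDetNeZero
    !![a, HahnSeries.single r (1 : F); 1, 0] (by simp [Matrix.det_fin_two])

theorem ballVertex_eq (a : KP F) (r : ℤ) : ballVertex a r = ballMat a r • stdVertex F := rfl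

theorem ballMat_val (a : KP F) (r : ℤ) : (ballMat a r).1 = !![a, unif F r; 1, 0] := rfl

theorem det_ballMat (a : KP F) (r : ℤ) : (ballMat a r).1.det = -unif F r := by
  rw [ballMat_val]
  simp [Matrix.det_fin_two]

theorem adjugate_ballMat_mul (a : KP F) (r : ℤ) (p q s w : KP F) :
    (ballMat a r).1.adjugate * !![p, q; s, w] =
      !![-(unif F r * s), -(unif F r * w); a * s - p, a * w - q] := by
  rw [ballMat_val, Matrix.adjugate_fin_two_of, Matrix.mul_fin_two]
  congr 1
  simp [sub_eq_add_neg, add_comm]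

/-- Up to a scalar, `Q` is g⁻¹h; taking determinants in the last two hypotheses shows that `u` is
inverse to det `Q`, so `Q` is invertible over the integers. -/
theorem smul_stdVertex_eq_of_factor (g h : GL (Fin 2) (KP F)) (c u : KP F) (Q : Mat F)
    (hu : u ∈ integers F) (hQ : ∀ i j, Q i j ∈ integers F) (hc : c * c = g.1.det * h.1.det * u)
    (hgh : g.1.adjugate * h.1 = c • Q) : h • stdVertex F = g • stdVertex F := by
  have hg0 := det_ne_zero g
  have hh0 := det_ne_zero h
  rw [smul_stdVertex_eq_iff g h (g.1.det * h.1.det)⁻¹ (by field_simp)]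
  intro i j k l
  have : (g.1.det * h.1.det)⁻¹ * ((c • Q) i j * (c • Q) k l) = u * (Q i j * Q k l) := by
    simp only [Matrix.smul_apply, smul_eq_mul]
    calc _ = (g.1.det * h.1.det)⁻¹ * (c * c) * (Q i j * Q k l) := by ring
      _ = _ := by rw [hc]; field_simp
  rw [hgh, this]
  exact mul_mem hu (mul_mem (hQ i j) (hQ k l))

/-- Every vertex of the tree is a ball. -/
theorem exists_eq_ballVertex (x : Vertex F) : ∃ a r, x = ballVertex a r := by
  have main : ∀ (g : GL (Fin 2) (KP F)) (α : KP F), α ∈ integers F → g.1 1 1 = α * g.1 1 0 →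
      ∃ a r, g • stdVertex F = ballVertex a r := by
    intro g α hα h
    have hdet := det_ne_zero g
    have hg : g.1 = !![g.1 0 0, g.1 0 1; g.1 1 0, g.1 1 1] := Matrix.eta_fin_two g.1
    rw [Matrix.det_fin_two, h] at hdet
    generalize hp : g.1 0 0 = p at *
    generalize hq : g.1 0 1 = q at *
    generalize hs : g.1 1 0 = s at *
    have hs0 : s ≠ 0 := by rintro rfl; simp at hdet
    have hq0 : α * p - q ≠ 0 := by
      intro h0
      apply hdet
      linear_combination s * h0
    -- Subtracting α times the first column from the second clears the lower right entry. After
    -- division by s, the first column gives the center p/s, and the valuation of the remaining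
    -- entry gives the radius.
    obtain ⟨r, u, hu, hru⟩ := exists_unit_mul_unif (div_ne_zero hq0 hs0)
    obtain ⟨v, hv⟩ := hu.exists_right_inv
    have huv : algebraMap F⟦X⟧ (KP F) u * algebraMap F⟦X⟧ (KP F) v = 1 := by
      rw [← map_mul, hv, map_one]
    have hru' : α * p - q = s * (unif F r * algebraMap F⟦X⟧ (KP F) u) := by
      rw [← hru]
      field_simp
    refine ⟨p / s, r, ?_⟩
    rw [ballVertex_eq]
    refine smul_stdVertex_eq_of_factor _ _ (s * unif F r) (-algebraMap F⟦X⟧ (KP F) v)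
      !![-1, -α; 0, algebraMap F⟦X⟧ (KP F) u] (neg_mem (algebraMap_mem_integers v)) ?_ ?_ ?_
    · simp [Fin.forall_fin_two, hα, one_mem, zero_mem]
      exact algebraMap_mem_integers u
    · rw [det_ballMat, Matrix.det_fin_two, hp, hq, hs, h]
      have : p * (α * s) - q * s = s * (s * (unif F r * algebraMap F⟦X⟧ (KP F) u)) := by
        linear_combination s * hru'
      rw [this]
      linear_combination (-s * s * unif F r * unif F r) * huv
    · rw [hg, adjugate_ballMat_mul, h]
      have h1 : p / s * s - p = 0 := by field_simp; ring
      have h2 : p / s * (α * s) - q = s * unif F r * algebraMap F⟦X⟧ (KP F) u := by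
        have : p / s * (α * s) = α * p := by field_simp
        rw [this, hru']
        ring
      rw [h1, h2]
      ext1 i j
      fin_cases i <;> fin_cases j <;> simp <;> ring
  obtain ⟨g, rfl⟩ := exists_smul_stdVertex x
  -- In a valuation ring one of the two bottom entries divides the other; exchanging the columns
  -- does not change the vertex.
  rcases div_mem_or_div_mem (g.1 1 1) (g.1 1 0) with ⟨α, hα, h⟩ | ⟨α, hα, h⟩
  · exact main g α hα h
  · have hsw : g • stdVertex F = (g * swapMatrix F) • stdVertex F := by
      rw [mul_smul, swap_smul_stdVertex]
    rw [hsw]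
    refine main _ α hα ?_
    simpa [swapMatrix, Matrix.GeneralLinearGroup.mkOfDetNeZero, Matrix.mul_apply,
      Fin.sum_univ_two] using h

theorem ballVertex_eq_iff (a b : KP F) (r s : ℤ) :
    ballVertex b s = ballVertex a r ↔ s = r ∧ (a - b) * unif F (-r) ∈ integers F := by
  have hd : unif F (-(r + s)) * ((ballMat a r).1.det * (ballMat b s).1.det) = 1 := by
    rw [det_ballMat, det_ballMat, neg_mul_neg, ← unif_add, ← unif_add, neg_add_cancel, unif_zero]
  rw [ballVertex_eq, ballVertex_eq, smul_stdVertex_eq_iff _ _ _ hd, ballMat_val b s,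
    adjugate_ballMat_mul]
  constructor
  · intro h
    have h1 := h 0 0 0 0
    have h2 := h 1 1 1 1
    have h3 := h 1 0 0 0
    simp [← unif_add, unif_mem_integers] at h1 h2
    obtain rfl : s = r := by omega
    refine ⟨rfl, ?_⟩
    simp only [Matrix.of_apply, Matrix.cons_val_zero, Matrix.cons_val_one, mul_one, mul_neg,
      neg_mem_iff] at h3
    convert h3 using 1
    rw [mul_left_comm, ← unif_add]
    congr 2
    ring
  · rintro ⟨rfl, h⟩
    have key : !![-(unif F s * 1), -(unif F s * 0); a * 1 - b, a * 0 - unif F s] =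
        unif F s • !![-1, 0; (a - b) * unif F (-s), -1] := by
      have h0 := unif_ne_zero (F := F) s
      ext1 i j
      fin_cases i <;> fin_cases j <;> simp [unif_neg]
      field_simp
    rw [key]
    have hQ : ∀ i j, (!![-1, 0; (a - b) * unif F (-s), -1] : Mat F) i j ∈ integers F := by
      simp [Fin.forall_fin_two, h, one_mem, zero_mem]
    intro i j k l
    have : unif F (-(s + s)) * unif F s * unif F s = 1 := by
      rw [← unif_add, ← unif_add, ← unif_zero]
      congr 1
      ring
    simp only [Matrix.smul_apply, smul_eq_mul]
    have h2 := mul_mem (hQ i j) (hQ k l)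
    convert h2 using 1
    linear_combination (!![-1, 0; (a - b) * unif F (-s), -1] : Mat F) i j *
      (!![-1, 0; (a - b) * unif F (-s), -1] : Mat F) k l * this

theorem adj_ballVertex (a : KP F) (r : ℤ) : (tree F).Adj (ballVertex a r) (ballVertex a (r + 1)) := by
  refine ⟨ballMat a r * swapMatrix F, ?_, ?_⟩
  · rw [mul_smul, swap_smul_stdVertex, ballVertex_eq]
  · have h : ballMat a r * swapMatrix F * stepMatrix F = ballMat a (r + 1) * swapMatrix F := by
      apply Units.ext
      simp only [Units.val_mul, ballMat_val, unif_add]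
      ext1 i j
      fin_cases i <;> fin_cases j <;>
        simp [swapMatrix, stepMatrix, Matrix.GeneralLinearGroup.mkOfDetNeZero, unif]
    rw [h, mul_smul, swap_smul_stdVertex, ballVertex_eq]

theorem adj_ballVertex_iff (a : KP F) (r : ℤ) (y : Vertex F) :
    (tree F).Adj (ballVertex a r) y ↔
      y = ballVertex a (r - 1) ∨ ∃ b : F, y = ballVertex (a + HahnSeries.C b * unif F r) (r + 1) := by
  constructor
  · intro hadj
    obtain ⟨b, s, rfl⟩ := exists_eq_ballVertex y
    have hne := hadj.ne
    have hd : unif F (1 - r - s) * ((ballMat a r).1.det * (ballMat b s).1.det) = unif F 1 := by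
      rw [det_ballMat, det_ballMat, neg_mul_neg, ← unif_add, ← unif_add]
      congr 1
      ring
    have h := unif_smul_mem_of_adj hadj
    rw [ballVertex_eq, ballVertex_eq, smul_mem_smul_stdVertex_iff _ _ _ _ hd, ballMat_val b s,
      adjugate_ballMat_mul] at h
    have h1 := h 0 0 0 0
    have h2 := h 1 1 1 1
    have h3 := h 1 0 1 0
    simp [← unif_add, unif_mem_integers] at h1 h2
    simp only [Matrix.of_apply, Matrix.cons_val_zero, Matrix.cons_val_one, mul_one] at h3
    rw [mul_comm] at h3
    -- The diagonal coefficients bound |s - r| by one, and the square of a - b then controls the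
    -- centers. The case s = r would give the same ball.
    obtain rfl | rfl | rfl : s = r ∨ s = r - 1 ∨ s = r + 1 := by omega
    · refine absurd ?_ hne.symm
      rw [ballVertex_eq_iff]
      exact ⟨rfl, mul_unif_mem_of_sq h3 (by omega)⟩
    · left
      rw [ballVertex_eq_iff]
      exact ⟨rfl, mul_unif_mem_of_sq h3 (by omega)⟩
    · right
      obtain ⟨c, hc⟩ := exists_const_sub_mem (mul_unif_mem_of_sq h3 (l := -r) (by omega))
      refine ⟨-c, ?_⟩
      rw [ballVertex_eq_iff]
      refine ⟨rfl, ?_⟩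
      convert hc using 2
      · rw [neg_neg, map_neg]
        ring
      · congr 1
        ring
  · rintro (rfl | ⟨b, rfl⟩)
    · have := (adj_ballVertex a (r - 1)).symm
      rwa [sub_add_cancel] at this
    · have : ballVertex a r = ballVertex (a + HahnSeries.C b * unif F r) r := by
        rw [ballVertex_eq_iff]
        refine ⟨rfl, ?_⟩
        rw [add_sub_cancel_left, mul_assoc, ← unif_add, add_neg_cancel, unif_zero, mul_one]
        exact const_mem_integers b
      rw [this]
      exact adj_ballVertex _ _

theorem ballVertex_branch_injective (a : KP F) (r : ℤ) {b c : F}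
    (h : ballVertex (a + HahnSeries.C b * unif F r) (r + 1) =
      ballVertex (a + HahnSeries.C c * unif F r) (r + 1)) : b = c := by
  rw [ballVertex_eq_iff] at h
  have h2 : HahnSeries.C (c - b) * unif F (-1) ∈ integers F := by
    convert h.2 using 1
    have : unif F (-1) = unif F r * unif F (-(r + 1)) := by
      rw [← unif_add]
      congr 1
      ring
    rw [this, map_sub]
    ring
  exact (sub_eq_zero.mp (const_mul_unif_mem h2 (by norm_num))).symm

/-- The Bruhat–Tits tree is connected. -/
theorem tree_preconnected : (tree F).Preconnected := by
  have hray : ∀ (a : KP F) (r : ℤ) (k : ℕ),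
      (tree F).Reachable (ballVertex a r) (ballVertex a (r + k)) := by
    intro a r k
    induction k with
    | zero => simp
    | succ k ih =>
      refine ih.trans ?_
      push_cast
      rw [← add_assoc]
      exact (adj_ballVertex a _).reachable
  have hbase : ∀ x : Vertex F, (tree F).Reachable (ballVertex 0 0) x := by
    intro x
    obtain ⟨a, r, rfl⟩ := exists_eq_ballVertex x
    obtain ⟨k, hk⟩ := exists_mul_unif_mem a
    -- A ball around 0 with exponent k + |r| contains a and has radius at least that of the target,
    -- so both vertices are reached from it along decreasing rays.
    have h1 := hray 0 (-((k + r.natAbs : ℕ) : ℤ)) (k + r.natAbs)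
    have h2 := hray a (-((k + r.natAbs : ℕ) : ℤ)) (k + r.natAbs + r).natAbs
    rw [neg_add_cancel] at h1
    have he : -((k + r.natAbs : ℕ) : ℤ) + (((k + r.natAbs + r : ℤ).natAbs : ℕ) : ℤ) = r := by omega
    rw [he] at h2
    refine h1.symm.trans ?_
    have : ballVertex (0 : KP F) (-((k + r.natAbs : ℕ) : ℤ)) =
        ballVertex a (-((k + r.natAbs : ℕ) : ℤ)) := by
      rw [ballVertex_eq_iff]
      refine ⟨rfl, ?_⟩
      rw [sub_zero, neg_neg]
      exact mul_unif_mem_of_le hk (by omega)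
    rw [this]
    exact h2
  exact fun x y => (hbase x).symm.trans (hbase y)

end Balls

/-! ### Translates of the standard balls under polynomial matrices: stabilizers, orbits and
neighbors. -/

section Stages

variable {F : Type*} [Field F]

/-- A matrix over `F[t]`, seen over the completion. -/
noncomputable abbrev emb : GL (Fin 2) F[X] →* GL (Fin 2) (KP F) :=
  Matrix.GeneralLinearGroup.map (polyEmb F)

/-- The image under `γ` of the ball with center `0` and radius `|t ^ n|`. -/
noncomputable def stage (γ : GL (Fin 2) F[X]) (n : ℕ) : Vertex F := emb γ • ballVertex 0 (-n)

theorem emb_smul_stage (γ δ : GL (Fin 2) F[X]) (n : ℕ) : emb γ • stage δ n = stage (γ * δ) n := by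
  rw [stage, stage, map_mul, mul_smul]

theorem stage_one (n : ℕ) : stage (1 : GL (Fin 2) F[X]) n = ballVertex 0 (-n) := by
  rw [stage, map_one, one_smul]

/-- The stabilizer of the ball with center `0` and radius `|t ^ n|` in `GL₂(F[t])`. -/
def StageStabilizes (n : ℕ) (s : GL (Fin 2) F[X]) : Prop :=
  (s.1 0 0).natDegree = 0 ∧ (s.1 1 1).natDegree = 0 ∧ (s.1 0 1).natDegree ≤ n ∧
    (s.1 1 0 = 0 ∨ n = 0 ∧ (s.1 1 0).natDegree = 0)

theorem exists_det_eq_C (s : GL (Fin 2) F[X]) : ∃ u : F, u ≠ 0 ∧ s.1.det = C u := by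
  obtain ⟨u, hu, h⟩ := Polynomial.isUnit_iff.mp ((Matrix.isUnit_iff_isUnit_det _).mp s.isUnit)
  exact ⟨u, hu.ne_zero, h.symm⟩

theorem emb_val (s : GL (Fin 2) F[X]) : (emb s).1 = s.1.map (polyEmb F) := rfl

theorem emb_mul_ballMat_val (s : GL (Fin 2) F[X]) (n : ℤ) :
    (emb s * ballMat 0 n).1 = !![polyEmb F (s.1 0 1), polyEmb F (s.1 0 0) * unif F n;
      polyEmb F (s.1 1 1), polyEmb F (s.1 1 0) * unif F n] := by
  rw [Units.val_mul, emb_val, ballMat_val]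
  ext1 i j
  fin_cases i <;> fin_cases j <;> simp [Matrix.mul_apply, Fin.sum_univ_two]

theorem det_emb_mul_ballMat {s : GL (Fin 2) F[X]} {u : F} (hu : s.1.det = C u) (n : ℤ) :
    (emb s * ballMat 0 n).1.det = -(HahnSeries.C u * unif F n) := by
  have : (s.1.map (polyEmb F)).det = HahnSeries.C u := by
    rw [← polyEmb_C, ← hu, RingHom.map_det]
    rfl
  rw [Units.val_mul, Matrix.det_mul, det_ballMat, emb_val, this]
  ring

/-- The integrality criterion bounds twice the degree of each nonzero entry: by n - m and m - n on
the diagonal, by n + m and -n - m off it. Invertibility of `s` turns these bounds into n = m and the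
shape of the stabilizer. -/
theorem emb_smul_ballVertex_eq_iff (s : GL (Fin 2) F[X]) (n m : ℕ) :
    emb s • ballVertex (0 : KP F) (-n) = ballVertex (0 : KP F) (-m) ↔ n = m ∧ StageStabilizes n s := by
  obtain ⟨u, hu0, hu⟩ := exists_det_eq_C s
  have hCu : (HahnSeries.C u⁻¹ : KP F) * HahnSeries.C u = 1 := by
    rw [← map_mul, inv_mul_cancel₀ hu0, map_one]
  have hdet : s.1 0 0 * s.1 1 1 - s.1 0 1 * s.1 1 0 ≠ 0 := by
    rw [← Matrix.det_fin_two, hu]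
    simpa using hu0
  rw [ballVertex_eq, ballVertex_eq, ← mul_smul]
  constructor
  · have hd : unif F (m + n) * HahnSeries.C u⁻¹ *
        ((ballMat (0 : KP F) (-m)).1.det * (emb s * ballMat 0 (-n)).1.det) = 1 := by
      rw [det_ballMat, det_emb_mul_ballMat hu, unif_add, unif_neg, unif_neg]
      have h1 := unif_ne_zero (F := F) m
      have h2 := unif_ne_zero (F := F) n
      generalize (HahnSeries.C u⁻¹ : KP F) = v at hCu ⊢
      field_simp
      linear_combination hCu
    rw [smul_stdVertex_eq_iff _ _ _ hd, emb_mul_ballMat_val, adjugate_ballMat_mul]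
    intro h
    have key : ∀ (p : F[X]) (k l : ℤ) (x : KP F),
        (x = polyEmb F p * unif F l ∨ x = -(polyEmb F p * unif F l)) → m + n + 2 * l = k →
        unif F (m + n) * HahnSeries.C u⁻¹ * (x * x) ∈ integers F →
        p = 0 ∨ 2 * (p.natDegree : ℤ) ≤ k := by
      intro p k l x hx hk hmem
      rw [← polyEmb_sq_mul_unif_mem]
      have := mul_mem hmem (const_mem_integers u)
      convert this using 1
      rw [← hk, unif_add, two_mul, unif_add l l]
      have hxx : x * x = polyEmb F p * unif F l * (polyEmb F p * unif F l) := by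
        rcases hx with rfl | rfl
        · rfl
        · ring
      rw [hxx]
      linear_combination (-polyEmb F p * polyEmb F p * (unif F (↑m + ↑n) * (unif F l * unif F l))) *
        hCu
    have h1 := key (s.1 1 1) (n - m) (-m) _ (Or.inr (by simp [mul_comm])) (by ring) (h 0 0 0 0)
    have h2 := key (s.1 1 0) (-n - m) (-m - n) _
      (Or.inr (by simp [sub_eq_add_neg, unif_add, mul_left_comm])) (by ring) (h 0 1 0 1)
    have h3 := key (s.1 0 1) (n + m) 0 _ (Or.inr (by simp [unif_zero])) (by ring) (h 1 0 1 0)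
    have h4 := key (s.1 0 0) (m - n) (-n) _ (Or.inr (by simp)) (by ring) (h 1 1 1 1)
    -- A nonzero diagonal forces n = m; a nonzero lower left entry forces n = m = 0.
    have h5 : (s.1 0 0 ≠ 0 ∧ s.1 1 1 ≠ 0) ∨ (s.1 0 1 ≠ 0 ∧ s.1 1 0 ≠ 0) := by
      by_contra! hc
      apply hdet
      by_cases ha : s.1 0 0 = 0 <;> by_cases hb : s.1 0 1 = 0 <;> simp_all
    have hz : ∀ p : F[X], p = 0 → p.natDegree = 0 := by rintro p rfl; simp
    have z1 := h1.imp_left (hz _)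
    have z3 := h3.imp_left (hz _)
    have z4 := h4.imp_left (hz _)
    by_cases hc : s.1 1 0 = 0
    · have h6 : s.1 0 0 ≠ 0 ∧ s.1 1 1 ≠ 0 := by simpa [hc] using h5
      have e1 := h1.resolve_left h6.2
      have e4 := h4.resolve_left h6.1
      exact ⟨by omega, by omega, by omega, by omega, Or.inl hc⟩
    · have e2 := h2.resolve_left hc
      exact ⟨by omega, by omega, by omega, by omega, Or.inr ⟨by omega, by omega⟩⟩
  · rintro ⟨rfl, ha, hd, hb, hc⟩
    refine smul_stdVertex_eq_of_factor _ _ (unif F (-n)) (HahnSeries.C u⁻¹)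
      !![-polyEmb F (s.1 1 1), -(polyEmb F (s.1 1 0) * unif F (-n));
        -(polyEmb F (s.1 0 1) * unif F n), -polyEmb F (s.1 0 0)] (const_mem_integers _) ?_ ?_ ?_
    · have h0 : ∀ p : F[X], p.natDegree = 0 → polyEmb F p ∈ integers F := by
        intro p hp
        rw [← mul_one (polyEmb F p), ← unif_zero, polyEmb_mul_unif_mem]
        omega
      have h1 : polyEmb F (s.1 1 0) * unif F (-n) ∈ integers F := by
        rw [polyEmb_mul_unif_mem]
        exact hc.imp_right fun h => by omega
      have h2 : polyEmb F (s.1 0 1) * unif F n ∈ integers F := by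
        rw [polyEmb_mul_unif_mem]
        omega
      simp only [Fin.forall_fin_two, Matrix.of_apply, Matrix.cons_val_zero, Matrix.cons_val_one]
      exact ⟨⟨neg_mem (h0 _ hd), neg_mem h1⟩, neg_mem h2, neg_mem (h0 _ ha)⟩
    · rw [det_ballMat, det_emb_mul_ballMat hu]
      linear_combination -(unif F (-n) * unif F (-n)) * hCu
    · rw [emb_mul_ballMat_val, adjugate_ballMat_mul, unif_neg]
      have hn := unif_ne_zero (F := F) n
      ext1 i j
      fin_cases i <;> fin_cases j <;> simp <;> field_simp

theorem stage_eq_iff (γ δ : GL (Fin 2) F[X]) (n m : ℕ) :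
    stage γ n = stage δ m ↔ n = m ∧ StageStabilizes n (δ⁻¹ * γ) := by
  rw [← emb_smul_ballVertex_eq_iff, map_mul, mul_smul, map_inv, inv_smul_eq_iff]
  rfl

theorem hasType_stage (γ : GL (Fin 2) F[X]) (n : ℕ) : HasType (stage γ n) n := by
  refine ⟨γ⁻¹, ?_⟩
  change emb γ⁻¹ • stage γ n = _
  rw [emb_smul_stage, inv_mul_cancel, stage_one]

/-- Two stages are in the same orbit under `Γ₀(f)` when some matrix that stabilizes the standard
stage carries one matrix to the other modulo `Γ₀(f)`. -/
theorem exists_gamma0_smul_stage_iff (f : F[X]) (γ δ : GL (Fin 2) F[X]) (n m : ℕ) :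
    (∃ g : Gamma0KP f, g • stage γ n = stage δ m) ↔
      n = m ∧ ∃ s, StageStabilizes n s ∧ f ∣ (δ * s * γ⁻¹).1 1 0 := by
  constructor
  · rintro ⟨⟨_, g, hg, rfl⟩, h⟩
    change emb g • stage γ n = stage δ m at h
    rw [emb_smul_stage, stage_eq_iff] at h
    refine ⟨h.1, _, h.2, ?_⟩
    have : δ * (δ⁻¹ * (g * γ)) * γ⁻¹ = g := by group
    rw [this]
    exact hg
  · rintro ⟨rfl, s, hs, hf⟩
    refine ⟨⟨emb (δ * s * γ⁻¹), _, hf, rfl⟩, ?_⟩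
    change emb (δ * s * γ⁻¹) • stage γ n = stage δ n
    rw [emb_smul_stage, stage_eq_iff]
    refine ⟨rfl, ?_⟩
    have : δ⁻¹ * (δ * s * γ⁻¹ * γ) = s := by group
    rwa [this]

/-- The upper triangular unipotent matrices. -/
noncomputable def upper (p : F[X]) : GL (Fin 2) F[X] where
  val := !![1, p; 0, 1]
  inv := !![1, -p; 0, 1]
  val_inv := by simp [Matrix.one_fin_two]
  inv_val := by simp [Matrix.one_fin_two]

/-- The lower triangular unipotent matrices. -/
noncomputable def lower (p : F[X]) : GL (Fin 2) F[X] where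
  val := !![1, 0; p, 1]
  inv := !![1, 0; -p, 1]
  val_inv := by simp [Matrix.one_fin_two]
  inv_val := by simp [Matrix.one_fin_two]

variable (F) in
/-- The matrix over `F[t]` that exchanges the basis vectors. -/
noncomputable def weyl : GL (Fin 2) F[X] where
  val := !![0, 1; 1, 0]
  inv := !![0, 1; 1, 0]
  val_inv := by simp [Matrix.one_fin_two]
  inv_val := by simp [Matrix.one_fin_two]

theorem upper_smul_ballVertex (p : F[X]) (a : KP F) (r : ℤ) :
    emb (upper p) • ballVertex a r = ballVertex (a + polyEmb F p) r := by
  rw [ballVertex_eq, ballVertex_eq, ← mul_smul]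
  congr 1
  apply Units.ext
  rw [Units.val_mul, emb_val, ballMat_val, ballMat_val]
  ext1 i j
  fin_cases i <;> fin_cases j <;> simp [upper, Matrix.mul_apply, Fin.sum_univ_two]

theorem weyl_smul_ballVertex (r : ℤ) :
    emb (weyl F) • ballVertex 0 r = ballVertex (0 : KP F) (-r) := by
  rw [ballVertex_eq, ballVertex_eq, ← mul_smul]
  have hu : (weyl F).1.det = C (-1) := by simp [weyl, Matrix.det_fin_two]
  have hr := unif_ne_zero (F := F) r
  refine smul_stdVertex_eq_of_factor _ _ 1 (-1) !![0, -1; -1, 0]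
    (neg_mem (one_mem _)) ?_ ?_ ?_
  · simp [Fin.forall_fin_two, one_mem, zero_mem]
  · rw [det_ballMat, det_emb_mul_ballMat hu, unif_neg]
    simp
    field_simp
  · rw [emb_mul_ballMat_val, adjugate_ballMat_mul, unif_neg]
    ext1 i j
    fin_cases i <;> fin_cases j <;> simp [weyl]
    field_simp

/-- The constant term of p/t, as a power series in 1/t, is the leading coefficient of p, so p/t is a
unit. -/
theorem inv_polyEmb_mul_unif_mem {p : F[X]} (hp : p.natDegree = 1) :
    (polyEmb F p * unif F 1)⁻¹ ∈ integers F := by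
  have h : polyEmb F p * unif F 1 ∈ integers F := by
    rw [polyEmb_mul_unif_mem]
    omega
  obtain ⟨a, ha⟩ := h
  have hcoeff : PowerSeries.coeff 0 a = p.coeff 1 := by
    have h1 := congrArg (fun x : KP F => x.coeff 0) ha
    have h2 := polyEmb_coeff p 1
    simp only [LaurentSeries.coe_algebraMap, coeff_mul_unif, PowerSeries.coeff_coe, lt_self_iff_false,
      if_false, Int.natAbs_zero, zero_sub] at h1
    rw [h1, ← h2]
    rfl
  have hunit : IsUnit a := by
    rw [PowerSeries.isUnit_iff_constantCoeff, ← PowerSeries.coeff_zero_eq_constantCoeff_apply, hcoeff,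
      ← hp, coeff_natDegree, isUnit_iff_ne_zero, ne_eq, leadingCoeff_eq_zero]
    rintro rfl
    simp at hp
  obtain ⟨b, hb⟩ := hunit.exists_right_inv
  refine ⟨b, ?_⟩
  rw [← ha]
  apply eq_inv_of_mul_eq_one_right
  rw [← map_mul, hb, map_one]

/-- As a Möbius transformation, `lower p` is z ↦ z/(pz + 1) = 1/p - 1/(p(pz + 1)). A point with |z|
= |t|ᵐ, m ≥ 0, lands at distance |t|⁻ᵐ⁻² from 1/p, whence the shift by two. -/
theorem lower_smul_ballVertex {p : F[X]} (hp : p.natDegree = 1) (n : ℕ) :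
    emb (lower p) • ballVertex (0 : KP F) (-n) = ballVertex (polyEmb F p)⁻¹ (n + 2) := by
  rw [ballVertex_eq, ballVertex_eq, ← mul_smul]
  have hu : (lower p).1.det = C 1 := by simp [lower, Matrix.det_fin_two]
  have hr := unif_ne_zero (F := F) n
  have h1 := unif_ne_zero (F := F) 1
  have h2 : unif F 2 = unif F 1 * unif F 1 := unif_add 1 1
  have hp0 : polyEmb F p ≠ 0 := by
    rw [Ne, map_eq_zero_iff _ polyEmb_injective]
    rintro rfl
    simp at hp
  refine smul_stdVertex_eq_of_factor _ _ (unif F 1) 1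
    !![-unif F (n + 1), -(polyEmb F p * unif F 1); (polyEmb F p * unif F 1)⁻¹, 0] (one_mem _)
    ?_ ?_ ?_
  · have h3 : unif F ((n : ℤ) + 1) ∈ integers F := unif_mem_integers.mpr (by omega)
    have h4 : polyEmb F p * unif F 1 ∈ integers F := by
      rw [polyEmb_mul_unif_mem]
      omega
    simp only [Fin.forall_fin_two, Matrix.of_apply, Matrix.cons_val_zero, Matrix.cons_val_one]
    exact ⟨⟨neg_mem h3, neg_mem h4⟩, inv_polyEmb_mul_unif_mem hp, zero_mem _⟩
  · rw [det_ballMat, det_emb_mul_ballMat hu, unif_neg, unif_add, h2, map_one]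
    field_simp
  · rw [emb_mul_ballMat_val, adjugate_ballMat_mul, unif_neg, unif_add, unif_add, h2]
    ext1 i j
    fin_cases i <;> fin_cases j <;> simp [lower] <;> field_simp
    ring

/-- The neighbors of a stage. -/
noncomputable def stageNeighbor (γ : GL (Fin 2) F[X]) (n : ℕ) : Option F → Vertex F
  | none => emb γ • ballVertex 0 (-n - 1)
  | some b => emb γ • ballVertex (HahnSeries.C b * unif F (-n)) (-n + 1)

theorem adj_stage_iff (γ : GL (Fin 2) F[X]) (n : ℕ) (y : Vertex F) :
    (tree F).Adj (stage γ n) y ↔ ∃ i, stageNeighbor γ n i = y := by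
  have : (tree F).Adj (stage γ n) y ↔ (tree F).Adj (ballVertex 0 (-n : ℤ)) ((emb γ)⁻¹ • y) := by
    constructor
    · intro h
      have := tree_adj_smul (emb γ)⁻¹ _ _ h
      rwa [stage, inv_smul_smul] at this
    · intro h
      have := tree_adj_smul (emb γ) _ _ h
      rwa [smul_inv_smul] at this
  rw [this, adj_ballVertex_iff]
  simp only [inv_smul_eq_iff, zero_add, Option.exists, stageNeighbor]
  simp only [eq_comm]

theorem stageNeighbor_injective (γ : GL (Fin 2) F[X]) (n : ℕ) :
    Function.Injective (stageNeighbor γ n) := by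
  rintro (_ | b) (_ | c) h
  · rfl
  · have := (ballVertex_eq_iff _ _ _ _).mp (MulAction.injective _ h)
    omega
  · have := (ballVertex_eq_iff _ _ _ _).mp (MulAction.injective _ h)
    omega
  · have := MulAction.injective _ h
    rw [← zero_add (HahnSeries.C b * _), ← zero_add (HahnSeries.C c * _)] at this
    rw [ballVertex_branch_injective _ _ this]

theorem stageNeighbor_none (γ : GL (Fin 2) F[X]) (n : ℕ) :
    stageNeighbor γ n none = stage γ (n + 1) := by
  rw [stageNeighbor, stage]
  congr 2
  push_cast
  ring

/-- The sub-balls of B₀ at positive level have polynomial centers b tⁿ⁺¹, so polynomial translations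
reach them. -/
theorem stageNeighbor_succ_some (γ : GL (Fin 2) F[X]) (n : ℕ) (b : F) :
    stageNeighbor γ (n + 1) (some b) = stage (γ * upper (C b * X ^ (n + 1))) n := by
  rw [stageNeighbor, stage, map_mul, mul_smul, upper_smul_ballVertex, map_mul, map_pow, polyEmb_C,
    polyEmb_X, t_pow, zero_add]
  congr 2
  push_cast
  ring

/-- At level 0 the sub-balls have radius below one; the inversion z ↦ 1/z makes them stages of level
1. -/
theorem stageNeighbor_zero_some (γ : GL (Fin 2) F[X]) (b : F) :
    stageNeighbor γ 0 (some b) = stage (γ * (upper (C b) * weyl F)) 1 := by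
  rw [stageNeighbor, stage, map_mul, map_mul, mul_smul, mul_smul, weyl_smul_ballVertex,
    upper_smul_ballVertex, polyEmb_C, zero_add]
  simp [unif_zero]

end Stages

end BruhatTits

/-! ### Recognizing a quotient graph from a system of representatives. -/

section Quotient

variable {V W ι : Type*}

/-- The set of vertices equivalent to a representative is closed under passing to neighbors, hence
is everything by connectedness. The injective labeling `nbr` then turns weights into counts of
labels. -/
theorem exists_iso_weightedReducedFineQuotient [Nonempty W] (T : SimpleGraph V) (hT : T.Preconnected)
    (G : Type*) [Group G] [MulAction G V]
    (hG : ∀ (g : G) (x y : V), T.Adj x y → T.Adj (g • x) (g • y)) (D : WeightedReducedGraph W)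
    (σ : W → V) (nbr : W → ι → V) (tgt : W → ι → W) [Finite ι]
    (hinj : ∀ v, Function.Injective (nbr v)) (hnbr : ∀ v y, T.Adj (σ v) y ↔ ∃ i, nbr v i = y)
    (htgt : ∀ v i, ∃ g : G, g • σ (tgt v i) = nbr v i)
    (hσ : ∀ v w, (∃ g : G, g • σ v = σ w) → v = w)
    (hweight : ∀ v w, D.weight v w = Set.ncard {i | tgt v i = w})
    (hadj : ∀ v w, D.Adj v w ↔ D.weight v w ≠ 0) :
    ∃ φ : D.Iso (weightedReducedFineQuotient T G hG), ∀ v, Quotient.mk _ (σ v) = φ.toEquiv v := by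
  let π : W → MulAction.orbitRel.Quotient G V := fun v => Quotient.mk _ (σ v)
  have hπnbr : ∀ v i, (Quotient.mk _ (nbr v i) : MulAction.orbitRel.Quotient G V) = π (tgt v i) := by
    intro v i
    obtain ⟨g, hg⟩ := htgt v i
    exact Quotient.sound ⟨g, hg⟩
  have hπinj : Function.Injective π := by
    intro v w h
    obtain ⟨g, hg⟩ := Quotient.exact h
    exact (hσ w v ⟨g, hg⟩).symm
  have hstep : ∀ x y : V, T.Adj x y → (∃ v, π v = Quotient.mk _ x) → ∃ v, π v = Quotient.mk _ y := by
    rintro x y hxy ⟨v, hv⟩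
    obtain ⟨g, hg⟩ := Quotient.exact hv
    have h1 := hG g _ _ hxy
    change g • x = σ v at hg
    rw [hg] at h1
    obtain ⟨i, hi⟩ := (hnbr v _).mp h1
    refine ⟨tgt v i, ?_⟩
    rw [← hπnbr, hi]
    exact Quotient.sound ⟨g, rfl⟩
  have hπsurj : Function.Surjective π := by
    intro a
    induction a using Quotient.inductionOn with
    | h x =>
      obtain ⟨v₀⟩ := ‹Nonempty W›
      obtain ⟨p⟩ := hT (σ v₀) x
      have : ∀ {a b : V} (_ : T.Walk a b), (∃ v, π v = Quotient.mk _ a) →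
          ∃ v, π v = Quotient.mk _ b := by
        intro a b p
        induction p with
        | nil => exact id
        | cons h p ih => exact fun ha => ih (hstep _ _ h ha)
      exact this p ⟨v₀, rfl⟩
  have hset : ∀ v w, {y : V | T.Adj (σ v) y ∧
      (Quotient.mk _ y : MulAction.orbitRel.Quotient G V) = π w} =
        nbr v '' {i | tgt v i = w} := by
    intro v w
    ext y
    simp only [Set.mem_ofPred_eq, Set.mem_image]
    constructor
    · rintro ⟨h1, h2⟩
      obtain ⟨i, rfl⟩ := (hnbr v y).mp h1
      rw [hπnbr] at h2
      exact ⟨i, hπinj h2, rfl⟩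
    · rintro ⟨i, rfl, rfl⟩
      exact ⟨(hnbr v _).mpr ⟨i, rfl⟩, hπnbr v i⟩
  refine ⟨⟨Equiv.ofBijective π ⟨hπinj, hπsurj⟩, ?_, ?_⟩, fun v => rfl⟩
  · intro v w
    rw [hadj, hweight, ← Nat.pos_iff_ne_zero, Set.ncard_pos (Set.toFinite _), ← Set.image_nonempty
      (f := nbr v), ← hset]
    change (∃ x y : V, T.Adj x y ∧ Quotient.mk _ x = π v ∧ Quotient.mk _ y = π w) ↔ _
    constructor
    · rintro ⟨x, y, hxy, hx, hy⟩
      obtain ⟨g, hg⟩ := Quotient.exact hx.symm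
      change g • x = σ v at hg
      refine ⟨g • y, ?_, ?_⟩
      · rw [← hg]
        exact hG g _ _ hxy
      · rw [← hy]
        exact Quotient.sound ⟨g, rfl⟩
    · rintro ⟨y, h1, h2⟩
      exact ⟨σ v, y, h1, rfl, h2⟩
  · intro v w
    change neighborCount T G (σ v) (π w) = _
    rw [neighborCount, hset, Set.ncard_image_of_injective _ (hinj v), hweight]

theorem ncard_option_fiber [Fintype ι] [DecidableEq W] (a b w : W) (g : Option ι → W) (ha : g none = a)
    (hb : ∀ i, g (some i) = b) :
    Set.ncard {i | g i = w} =
      (if a = w then 1 else 0) + if b = w then Fintype.card ι else 0 := by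
  classical
  rw [Set.ncard_eq_toFinset_card']
  simp only [Set.toFinset_ofPred]
  rw [Finset.card_filter, Fintype.sum_option]
  simp only [ha, hb]
  split_ifs <;> simp

end Quotient

namespace BruhatTits

/-! ### Orbits of stages as classes of second rows modulo f. -/

section Rows

variable {F K R : Type*} [Field F] [Field K] [CommRing R] [Algebra K R]

/-- A model of the quotient ring `F[t] / (f)`, as an algebra over a field isomorphic to `F`, in which
every element is represented by a polynomial of degree at most one. -/
structure ResidueModel (f : F[X]) (K R : Type*) [Field K] [CommRing R] [Algebra K R] where
  /-- the identification of the fields of coefficients -/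
  ψ : F ≃+* K
  /-- the reduction map -/
  φ : F[X] →+* R
  φ_C : ∀ a, φ (C a) = algebraMap K R (ψ a)
  ker : ∀ p, φ p = 0 ↔ f ∣ p
  surj : ∀ r, ∃ p, p.natDegree ≤ 1 ∧ φ p = r

/-- The second row of a matrix modulo `f`. -/
noncomputable def ResidueModel.row {f : F[X]} (M : ResidueModel f K R) (γ : GL (Fin 2) F[X]) : R × R :=
  (M.φ (γ.1 1 0), M.φ (γ.1 1 1))

variable (K) in
/-- Equivalence of rows, up to scalars, under the stabilizer of the stage of level `n`. -/
def RowRel : ℕ → R × R → R × R → Prop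
  | 0, x, y => ∃ a b c d : K, a * d - b * c ≠ 0 ∧
      (y.1 * algebraMap K R a + y.2 * algebraMap K R c) * x.2 -
        (y.1 * algebraMap K R b + y.2 * algebraMap K R d) * x.1 = 0
  | _ + 1, x, y => ∃ a d : K, a ≠ 0 ∧ d ≠ 0 ∧ ∃ b : R,
      (y.1 * algebraMap K R a) * x.2 - (y.1 * b + y.2 * algebraMap K R d) * x.1 = 0

/-- Multiplied by det γ, a unit, the lower left entry of δsγ⁻¹ is the determinant formed by the
second rows of δs and γ. Its vanishing modulo f says that these rows define the same projective
point. -/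
theorem dvd_mul_inv_iff {f : F[X]} (M : ResidueModel f K R) (γ δ s : GL (Fin 2) F[X]) :
    f ∣ (δ * s * γ⁻¹).1 1 0 ↔
      ((M.row δ).1 * M.φ (s.1 0 0) + (M.row δ).2 * M.φ (s.1 1 0)) * (M.row γ).2 -
        ((M.row δ).1 * M.φ (s.1 0 1) + (M.row δ).2 * M.φ (s.1 1 1)) * (M.row γ).1 = 0 := by
  have hdet : IsUnit γ.1.det := (Matrix.isUnit_iff_isUnit_det _).mp γ.isUnit
  rw [← hdet.dvd_mul_right, ← M.ker]
  have h : (δ * s * γ⁻¹).1 * γ.1 * γ.1.adjugate = δ.1 * s.1 * γ.1.adjugate := by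
    congr 1
    rw [← Units.val_mul, ← Units.val_mul, inv_mul_cancel_right]
  rw [mul_assoc, Matrix.mul_adjugate] at h
  have h2 := congrFun (congrFun h 1) 0
  simp [Matrix.adjugate_fin_two, Matrix.mul_apply, Fin.sum_univ_two, Matrix.smul_apply] at h2
  rw [mul_comm]
  have h3 : (δ * s * γ⁻¹).1 1 0 * γ.1.det =
      (δ.1 1 0 * s.1 0 0 + δ.1 1 1 * s.1 1 0) * γ.1 1 1 -
        (δ.1 1 0 * s.1 0 1 + δ.1 1 1 * s.1 1 1) * γ.1 1 0 := by
    rw [← sub_eq_zero]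
    simp [Matrix.mul_apply, Fin.sum_univ_two] at h2 ⊢
    linear_combination h2
  rw [mul_comm, h3]
  simp [ResidueModel.row]

/-- Orbits of stages under `Γ₀(f)` in terms of the second rows. -/
theorem ResidueModel.smul_stage_iff {f : F[X]} (M : ResidueModel f K R) (γ δ : GL (Fin 2) F[X])
    (n m : ℕ) :
    (∃ g : Gamma0KP f, g • stage γ n = stage δ m) ↔ n = m ∧ RowRel K n (M.row γ) (M.row δ) := by
  rw [exists_gamma0_smul_stage_iff]
  refine and_congr_right fun _ => ?_
  simp only [dvd_mul_inv_iff M]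
  constructor
  · rintro ⟨s, ⟨ha, hd, hb, hc⟩, h⟩
    obtain ⟨u, hu0, hu⟩ := exists_det_eq_C s
    rw [Matrix.det_fin_two] at hu
    obtain ⟨a, ha'⟩ := natDegree_eq_zero.mp ha
    obtain ⟨d, hd'⟩ := natDegree_eq_zero.mp hd
    rw [← ha', ← hd', M.φ_C, M.φ_C] at h
    rw [← ha', ← hd'] at hu
    cases n with
    | zero =>
      obtain ⟨b, hb'⟩ := natDegree_eq_zero.mp (Nat.le_zero.mp hb)
      obtain ⟨c, hc'⟩ : ∃ c, C c = s.1 1 0 := by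
        rcases hc with hc | ⟨-, hc⟩
        · exact ⟨0, by rw [hc, C_0]⟩
        · exact natDegree_eq_zero.mp hc
      rw [← hb', ← hc', M.φ_C, M.φ_C] at h
      rw [← hb', ← hc', ← C_mul, ← C_mul, ← C_sub, C_inj] at hu
      refine ⟨_, _, _, _, ?_, h⟩
      rw [← map_mul, ← map_mul, ← map_sub, hu]
      simpa using hu0
    | succ n =>
      have hc' : s.1 1 0 = 0 := hc.resolve_right (by simp)
      rw [hc', map_zero, mul_zero, add_zero] at h
      rw [hc', mul_zero, sub_zero, ← C_mul, C_inj] at hu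
      have h0 : a * d ≠ 0 := hu ▸ hu0
      refine ⟨_, _, ?_, ?_, _, h⟩
      · simpa using left_ne_zero_of_mul h0
      · simpa using right_ne_zero_of_mul h0
  · intro h
    cases n with
    | zero =>
      obtain ⟨a, b, c, d, h0, h⟩ := h
      obtain ⟨s, hs⟩ : ∃ s : GL (Fin 2) F[X], s.1 = !![C (M.ψ.symm a), C (M.ψ.symm b);
          C (M.ψ.symm c), C (M.ψ.symm d)] := by
        refine ⟨Matrix.GeneralLinearGroup.mk'' _ ?_, rfl⟩
        rw [Matrix.det_fin_two_of, ← C_mul, ← C_mul, ← C_sub, isUnit_C, isUnit_iff_ne_zero]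
        intro h'
        apply h0
        simpa using congrArg M.ψ h'
      refine ⟨s, ?_, ?_⟩
      · simp [StageStabilizes, hs]
      · simpa [hs, M.φ_C] using h
    | succ n =>
      obtain ⟨a, d, ha, hd, β, h⟩ := h
      -- A representative of degree at most one is allowed in the corner at every level n + 1, so β
      -- may be arbitrary and the relation does not depend on n.
      obtain ⟨p, hp, rfl⟩ := M.surj β
      obtain ⟨s, hs⟩ : ∃ s : GL (Fin 2) F[X], s.1 = !![C (M.ψ.symm a), p; 0, C (M.ψ.symm d)] := by
        refine ⟨Matrix.GeneralLinearGroup.mk'' _ ?_, rfl⟩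
        rw [Matrix.det_fin_two_of, mul_zero, sub_zero, ← C_mul, isUnit_C, isUnit_iff_ne_zero]
        simp [ha, hd]
      refine ⟨s, ?_, ?_⟩
      · simp [StageStabilizes, hs]
        omega
      · simpa [hs, M.φ_C] using h

theorem RowRel.refl (n : ℕ) (x : R × R) : RowRel K n x x := by
  cases n with
  | zero => exact ⟨1, 0, 0, 1, by simp, by simp [mul_comm]⟩
  | succ n => exact ⟨1, 1, one_ne_zero, one_ne_zero, 0, by simp [mul_comm]⟩

/-- The level of a neighbor of a stage of level `n`. -/
def neighborLevel : ℕ → Option K → ℕ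
  | n, none => n + 1
  | 0, some _ => 1
  | n + 1, some _ => n

/-- The row of a neighbor of a stage, where `ξ` is the class of `t`. -/
def neighborRow (ξ : R) : ℕ → R × R → Option K → R × R
  | _, x, none => x
  | 0, x, some b => (x.1 * algebraMap K R b + x.2, x.1)
  | n + 1, x, some b => (x.1, x.1 * (algebraMap K R b * ξ ^ (n + 1)) + x.2)

theorem ResidueModel.exists_stageNeighbor {f : F[X]} (M : ResidueModel f K R)
    (γ : GL (Fin 2) F[X]) (n : ℕ) (o : Option F) :
    ∃ δ, stageNeighbor γ n o = stage δ (neighborLevel n (o.map M.ψ)) ∧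
      M.row δ = neighborRow (M.φ X) n (M.row γ) (o.map M.ψ) := by
  cases o with
  | none => exact ⟨γ, stageNeighbor_none γ n, by cases n <;> rfl⟩
  | some b =>
    cases n with
    | zero =>
      refine ⟨_, stageNeighbor_zero_some γ b, ?_⟩
      simp [ResidueModel.row, neighborRow, upper, weyl, Matrix.mul_apply, Fin.sum_univ_two, M.φ_C]
    | succ n =>
      refine ⟨_, stageNeighbor_succ_some γ n b, ?_⟩
      simp [ResidueModel.row, neighborRow, upper, Matrix.mul_apply, Fin.sum_univ_two, M.φ_C]

end Rows

/-! ### Reduction of the theorem to finite data on the finite part of a diagram. -/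

section Criterion

variable {F K R : Type*} [Field F] [Field K] [CommRing R] [Algebra K R] {k l : ℕ}

/-- The level of the stage over a vertex of a diagram, when the level of a vertex of the finite graph
is its type. -/
def diagramLevel (D : CuspDiagram k l) : D.Vertex → ℕ
  | Sum.inl i => D.vtype i
  | Sum.inr (c, m) => D.vtype (D.start c) + m + 1

/-- A value on the vertices of the diagram that is constant on the cusps. -/
def diagramValue {A : Type*} (D : CuspDiagram k l) (x : Fin k → A) (y : Fin l → A) : D.Vertex → A
  | Sum.inl i => x i
  | Sum.inr (c, _) => y c

/-- A vertex of the finite graph, or the first vertex of a cusp outside of the finite graph. -/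
def firstVertex (D : CuspDiagram k l) : Fin k ⊕ Fin l → D.Vertex
  | Sum.inl i => Sum.inl i
  | Sum.inr c => Sum.inr (c, 0)

/-- The classes of the neighbors of the stage over a vertex of a diagram. -/
def diagramTarget (D : CuspDiagram k l) (tgt : Fin k → Option K → Fin k ⊕ Fin l) :
    D.Vertex → Option K → D.Vertex
  | Sum.inl i, o => firstVertex D (tgt i o)
  | Sum.inr (c, m), none => Sum.inr (c, m + 1)
  | Sum.inr (c, m), some _ => D.cuspVertex c m

theorem firstVertex_injective (D : CuspDiagram k l) : Function.Injective (firstVertex D) := by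
  rintro (i | c) (j | c') h <;> simp_all [firstVertex]

/-- Only counts at finite vertices have to be supplied: beyond them, the label `none` moves outward
along the cusp and all the others move back. A finite vertex never reaches past the first vertex of
a cusp. -/
theorem diagram_weight_eq {ι : Type*} [Fintype ι] (D : CuspDiagram k l)
    (tgt : Fin k → Option ι → Fin k ⊕ Fin l) (hq : D.q = Fintype.card ι)
    (hcount : ∀ i w, D.weight (Sum.inl i) (firstVertex D w) =
      (Finset.univ.filter fun o => tgt i o = w).card) (v w : D.Vertex) :
    D.weight v w = Set.ncard {o | diagramTarget D tgt v o = w} := by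
  rcases v with i | ⟨c, m⟩
  · by_cases hw : ∃ u, firstVertex D u = w
    · obtain ⟨u, rfl⟩ := hw
      have : {o | diagramTarget D tgt (Sum.inl i) o = firstVertex D u} =
          ((Finset.univ.filter fun o => tgt i o = u : Finset (Option ι)) : Set (Option ι)) := by
        ext o
        simp [diagramTarget, (firstVertex_injective D).eq_iff]
      rw [hcount, this, Set.ncard_coe_finset]
    · have : {o | diagramTarget D tgt (Sum.inl i) o = w} = ∅ := by
        ext o
        simp only [Set.mem_ofPred_eq, Set.mem_empty_iff_false, iff_false]
        exact fun h => hw ⟨_, h⟩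
      rw [this, Set.ncard_empty]
      rcases w with j | ⟨c, _ | m⟩
      · exact absurd ⟨Sum.inl j, rfl⟩ hw
      · exact absurd ⟨Sum.inr c, rfl⟩ hw
      · simp [CuspDiagram.weight]
  · rw [ncard_option_fiber (Sum.inr (c, m + 1)) (D.cuspVertex c m) w _ rfl (fun _ => rfl), ← hq]
    rcases w with j | ⟨c', m'⟩
    · cases m <;> simp [CuspDiagram.weight, CuspDiagram.cuspVertex, eq_comm]
    · cases m with
      | zero =>
        simp [CuspDiagram.weight, CuspDiagram.cuspVertex, eq_comm]
      | succ m =>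
        simp only [CuspDiagram.weight, CuspDiagram.cuspVertex, Sum.inr.injEq, Prod.mk.injEq]
        by_cases hc : c = c' <;> by_cases h1 : m' = m + 1 + 1 <;> by_cases h2 : m' = m <;>
          simp [hc, h1, h2, eq_comm]
        all_goals grind

/-- Along a cusp the matrix stays fixed and only the level grows, so neighbors and inequivalence
there follow from the data at its start. `hmax` keeps the levels of cusp vertices above those of
finite vertices. `hzero` covers a cusp that starts at level 0, where the stabilizer cannot absorb a
multiple of the class of t. -/
theorem ResidueModel.isQuotientDiagram [Fintype K] {f : F[X]} (M : ResidueModel f K R)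
    (D : CuspDiagram k l) (lim : Fin l → OnePoint (KP F)) [NeZero k]
    (γ : Fin k → GL (Fin 2) F[X]) (δ : Fin l → GL (Fin 2) F[X]) (ρ : Fin k → R × R)
    (τ : Fin l → R × R) (ξ : R) (tgt : Fin k → Option K → Fin k ⊕ Fin l)
    (hξ : M.φ X = ξ) (hρ : ∀ i, M.row (γ i) = ρ i) (hτ : ∀ c, M.row (δ c) = τ c)
    (hstart : ∀ c, stage (γ (D.start c)) (D.vtype (D.start c)) =
      stage (δ c) (D.vtype (D.start c)))
    (hmax : ∀ i c, D.vtype i ≤ D.vtype (D.start c))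
    (hzero : ∀ c, D.vtype (D.start c) = 0 → ξ = 0)
    (hq : D.q = Fintype.card K)
    (hcount : ∀ i w, D.weight (Sum.inl i) (firstVertex D w) =
      (Finset.univ.filter fun o => tgt i o = w).card)
    (hlevel : ∀ i o, diagramLevel D (firstVertex D (tgt i o)) = neighborLevel (D.vtype i) o)
    (htgt : ∀ i o, RowRel K (neighborLevel (D.vtype i) o)
      (diagramValue D ρ τ (firstVertex D (tgt i o))) (neighborRow ξ (D.vtype i) (ρ i) o))
    (hne : ∀ i j, D.vtype i = D.vtype j → RowRel K (D.vtype i) (ρ i) (ρ j) → i = j)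
    (hneCusp : ∀ c c', RowRel K 1 (τ c) (τ c') → c = c')
    (hadj : ∀ i j, D.m i j ≠ 0 →
      (tree F).Adj (stage (γ i) (D.vtype i)) (stage (γ j) (D.vtype j)))
    (hlim : ∀ c, HasVisualLimit (fun n => stage (δ c) (D.vtype (D.start c) + n)) (lim c)) :
    IsQuotientDiagram f D lim := by
  subst hξ
  obtain rfl : ρ = fun i => M.row (γ i) := funext fun i => (hρ i).symm
  obtain rfl : τ = fun c => M.row (δ c) := funext fun c => (hτ c).symm
  have : Nonempty D.Vertex := ⟨Sum.inl 0⟩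
  have : Finite F := Finite.of_equiv K M.ψ.symm.toEquiv
  let rep : D.Vertex → GL (Fin 2) F[X] := diagramValue D γ δ
  let σ : D.Vertex → Vertex F := fun v => stage (rep v) (diagramLevel D v)
  have hrow : ∀ v, diagramValue D (fun i => M.row (γ i)) (fun c => M.row (δ c)) v = M.row (rep v) := by
    rintro (i | ⟨c, m⟩) <;> rfl
  have hcusp : ∀ c n, σ (D.cuspVertex c n) = stage (δ c) (D.vtype (D.start c) + n) := by
    rintro c (_ | n)
    · exact hstart c
    · rfl
  have hsmul : ∀ (v : D.Vertex) (o : Option F), ∃ g : Gamma0KP f,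
      g • σ (diagramTarget D tgt v (o.map M.ψ)) = stageNeighbor (rep v) (diagramLevel D v) o := by
    intro v o
    obtain ⟨η, h1, h2⟩ := M.exists_stageNeighbor (rep v) (diagramLevel D v) o
    rw [h1]
    rcases v with i | ⟨c, m⟩
    · rw [M.smul_stage_iff, h2, ← hrow]
      change diagramLevel D (firstVertex D (tgt i _)) = _ ∧
        RowRel K (diagramLevel D (firstVertex D (tgt i _))) _ _
      rw [hlevel]
      exact ⟨rfl, htgt i _⟩
    · cases o with
      | none =>
        change ∃ g : Gamma0KP f, g • stage (δ c) _ = _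
        rw [M.smul_stage_iff, h2]
        exact ⟨rfl, RowRel.refl _ _⟩
      | some b =>
        change ∃ g : Gamma0KP f, g • σ (D.cuspVertex c m) = _
        rw [hcusp, M.smul_stage_iff, h2]
        refine ⟨rfl, ?_⟩
        have hz : D.vtype (D.start c) + m = 0 → M.φ X = 0 := fun h => hzero c (by omega)
        change RowRel K (D.vtype (D.start c) + m) (M.row (δ c)) ((M.row (δ c)).1, (M.row (δ c)).1 *
          (algebraMap K R (M.ψ b) * M.φ X ^ (D.vtype (D.start c) + m + 1)) + (M.row (δ c)).2)
        generalize D.vtype (D.start c) + m = N at hz ⊢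
        cases N with
        | zero =>
          rw [hz rfl, zero_pow (Nat.succ_ne_zero _), mul_zero, mul_zero, zero_add]
          exact RowRel.refl _ _
        | succ N =>
          -- A unipotent stabilizing element undoes the translation that leads to this neighbor.
          refine ⟨1, 1, one_ne_zero, one_ne_zero,
            -(algebraMap K R (M.ψ b) * M.φ X ^ (N + 1 + 1)), ?_⟩
          simp only [map_one]
          ring
  have hinj : ∀ v w, (∃ g : Gamma0KP f, g • σ v = σ w) → v = w := by
    intro v w h
    rw [M.smul_stage_iff] at h
    obtain ⟨h1, h2⟩ := h
    rcases v with i | ⟨c, m⟩ <;> rcases w with j | ⟨c', m'⟩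
    · exact congrArg Sum.inl (hne i j h1 h2)
    -- Equal levels are impossible here: cusp vertices lie strictly above every finite vertex.
    · have := hmax i c'
      simp only [diagramLevel] at h1
      omega
    · have := hmax j c
      simp only [diagramLevel] at h1
      omega
    -- The relation at any positive level is definitionally the one at level 1.
    · obtain rfl := hneCusp c c' h2
      simp only [diagramLevel] at h1
      obtain rfl : m = m' := by omega
      rfl
  obtain ⟨φ, hφ⟩ := exists_iso_weightedReducedFineQuotient (tree F) tree_preconnected (Gamma0KP f)
    (fun g x y h => tree_adj_smul g.1 x y h) D.graph σ
    (fun v => stageNeighbor (rep v) (diagramLevel D v))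
    (fun v o => diagramTarget D tgt v (o.map M.ψ))
    (fun v => stageNeighbor_injective _ _) (fun v y => adj_stage_iff _ _ y) hsmul hinj
    (fun v w => by
      change D.weight v w = _
      rw [diagram_weight_eq D tgt hq hcount]
      let e : Option F ≃ Option K := Equiv.optionCongr M.ψ.toEquiv
      rw [← Set.ncard_preimage_of_injective_subset_range e.injective (by simp)]
      rfl)
    (fun v w => Iff.rfl)
  refine ⟨φ, σ, hφ, ?_, fun i => hasType_stage _ _, fun c => ?_⟩
  · have hray : ∀ c n, (tree F).Adj (σ (D.cuspVertex c n)) (σ (D.cuspVertex c (n + 1))) := by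
      intro c n
      rw [hcusp, hcusp, adj_stage_iff]
      exact ⟨none, stageNeighbor_none _ _⟩
    rintro (i | ⟨c, m⟩) (j | ⟨c', m'⟩) h
    · exact hadj i j h
    · change D.weight _ _ ≠ 0 at h
      simp only [CuspDiagram.weight] at h
      obtain ⟨⟨rfl, rfl⟩, -⟩ := ite_ne_right_iff.mp h
      exact hray c' 0
    · change D.weight _ _ ≠ 0 at h
      simp only [CuspDiagram.weight] at h
      obtain ⟨⟨rfl, rfl⟩, -⟩ := ite_ne_right_iff.mp h
      exact (hray c 0).symm
    · change D.weight _ _ ≠ 0 at h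
      simp only [CuspDiagram.weight] at h
      split_ifs at h with h1 h2
      · obtain ⟨rfl, rfl⟩ := h1
        exact hray c (m + 1)
      · obtain ⟨rfl, rfl⟩ := h2
        exact (hray c (m' + 1)).symm
      · exact absurd rfl h
  · have := hlim c
    simp only [hcusp]
    exact this

end Criterion

/-! ### Visual limits of the cusps and adjacency of the chosen lifts. -/

section Limits

variable {F : Type*} [Field F]

theorem hasVisualLimit_weyl (k : ℕ) :
    HasVisualLimit (fun n => stage (weyl F) (k + n)) ((0 : KP F) : OnePoint (KP F)) := by
  refine ⟨k, fun n => ?_⟩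
  change stage (weyl F) (k + n) = _
  rw [stage, weyl_smul_ballVertex]
  simp

theorem hasVisualLimit_one (k : ℕ) :
    HasVisualLimit (fun n => stage (1 : GL (Fin 2) F[X]) (k + n)) OnePoint.infty := by
  refine ⟨0, -k, fun n => ?_⟩
  change stage (1 : GL (Fin 2) F[X]) (k + n) = _
  rw [stage_one]
  congr 1
  push_cast
  ring

theorem hasVisualLimit_lower {p : F[X]} (hp : p.natDegree = 1) {a : KP F} (ha : polyEmb F p = a)
    (k : ℕ) :
    HasVisualLimit (fun n => stage (lower p) (k + n)) ((a⁻¹ : KP F) : OnePoint (KP F)) := by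
  subst ha
  refine ⟨k + 2, fun n => ?_⟩
  change stage (lower p) (k + n) = _
  rw [stage, lower_smul_ballVertex hp]
  congr 1
  push_cast
  ring

theorem adj_stage_succ (γ : GL (Fin 2) F[X]) (n : ℕ) :
    (tree F).Adj (stage γ n) (stage γ (n + 1)) := by
  rw [adj_stage_iff]
  exact ⟨none, stageNeighbor_none _ _⟩

theorem adj_stage_one_weyl : (tree F).Adj (stage (1 : GL (Fin 2) F[X]) 0) (stage (weyl F) 1) := by
  have h : stage (weyl F) 0 = stage 1 0 := by
    rw [stage_eq_iff]
    simp [StageStabilizes, weyl]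
  rw [← h]
  exact adj_stage_succ _ _

/-- Right multiplication by `weyl` does not change a stage of level 0, while `weyl` conjugates
`lower p` into `upper p`, which stabilizes level 1 in this degree. -/
theorem adj_stage_lower_weyl {p : F[X]} (hp : p.natDegree ≤ 1) :
    (tree F).Adj (stage (lower p) 0) (stage (weyl F) 1) := by
  have h0 : stage (lower p * weyl F) 0 = stage (lower p) 0 := by
    rw [stage_eq_iff, inv_mul_cancel_left]
    simp [StageStabilizes, weyl]
  have h1 : stage (lower p * weyl F) 1 = stage (weyl F) 1 := by
    have : (weyl F)⁻¹ * (lower p * weyl F) = upper p := by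
      rw [inv_mul_eq_iff_eq_mul]
      apply Units.ext
      simp [weyl, lower, upper]
    rw [stage_eq_iff, this]
    simpa [StageStabilizes, upper] using hp
  rw [← h0, ← h1]
  exact adj_stage_succ _ _

/-- Both matrices give the same stage of level 0, since they differ by a constant matrix on the
right. -/
theorem adj_stage_lower_lower {p q : F[X]} (hpq : (p - q).natDegree = 0) :
    (tree F).Adj (stage (lower p) 0) (stage (lower q) 1) := by
  have h : stage (lower q) 0 = stage (lower p) 0 := by
    have : (lower p)⁻¹ * lower q = lower (q - p) := by
      rw [inv_mul_eq_iff_eq_mul]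
      apply Units.ext
      simp [lower]
    rw [stage_eq_iff, this]
    rw [← neg_sub, natDegree_neg] at hpq
    simp [StageStabilizes, lower, hpq]
  rw [← h]
  exact adj_stage_succ _ _

end Limits

/-! ### The case f = t. -/

section Models

variable {F : Type*} [Field F]

variable (F) in
/-- The residue ring of `F[t]` at `t = 0`. -/
noncomputable def linearModel : ResidueModel (X : F[X]) F F where
  ψ := RingEquiv.refl F
  φ := evalRingHom 0
  φ_C a := by simp
  ker p := by rw [X_dvd_iff, coeff_zero_eq_eval_zero]; rfl
  surj r := ⟨C r, by simp, by simp⟩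

theorem isQuotientDiagram_linear [Fintype F] :
    IsQuotientDiagram (X : F[X]) (diagramLinear (Fintype.card F) Fintype.card_ne_zero)
      ![((0 : KP F) : OnePoint (KP F)), OnePoint.infty] := by
  refine (linearModel F).isQuotientDiagram _ _ ![1] ![weyl F, 1] ![(0, 1)] ![(1, 0), (0, 1)] 0
    (fun _ o => o.elim (Sum.inr 1) fun _ => Sum.inr 0) ?_ ?_ ?_ ?_ ?_ ?_ rfl ?_ ?_ ?_ ?_ ?_ ?_ ?_
  · simp [linearModel]
  · simp [ResidueModel.row, linearModel]
  · simp [Fin.forall_fin_two, ResidueModel.row, linearModel, weyl]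
  -- The exchange matrix is constant, so both cusps start at the same vertex of level 0.
  · have h : stage 1 0 = stage (weyl F) 0 := by
      rw [stage_eq_iff]
      refine ⟨rfl, ?_⟩
      have : (weyl F)⁻¹ = weyl F := rfl
      rw [this]
      simp [StageStabilizes, weyl]
    simpa [Fin.forall_fin_two, diagramLinear] using h
  · simp [diagramLinear]
  · simp
  · intro i w
    rw [Finset.card_filter, Fintype.sum_option]
    fin_cases i
    rcases w with j | c
    · fin_cases j
      simp [firstVertex, diagramLinear, CuspDiagram.weight]
    · fin_cases c <;> simp [firstVertex, diagramLinear, CuspDiagram.weight]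
  · rintro i (_ | b) <;> fin_cases i <;> rfl
  · rintro i (_ | b) <;> fin_cases i
    · exact RowRel.refl _ _
    · have : neighborRow (0 : F) 0 ((0 : F), (1 : F)) (some b) = (1, 0) := by simp [neighborRow]
      change RowRel F 1 (1, 0) (neighborRow (0 : F) 0 ((0 : F), (1 : F)) (some b))
      rw [this]
      exact RowRel.refl _ _
  · intro i j _ _
    exact Subsingleton.elim i j
  · intro c c' h
    obtain ⟨a, d, ha, hd, b, h⟩ := h
    fin_cases c <;> fin_cases c' <;> simp_all
  · intro i j h
    fin_cases i
    fin_cases j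
    simp [diagramLinear] at h
  · intro c
    fin_cases c
    · exact hasVisualLimit_weyl 0
    · exact hasVisualLimit_one 0

end Models

/-! ### Residue rings of quadratic polynomials over two elements. -/

section Quadratic

variable {F : Type*} [Field F]

instance (a b : ZMod 2) : Fintype (QuadraticAlgebra (ZMod 2) a b) :=
  Fintype.ofEquiv _ (QuadraticAlgebra.equivProd a b).symm

instance (a b : ZMod 2) : DecidableEq (QuadraticAlgebra (ZMod 2) a b) := fun x y =>
  decidable_of_iff (x.re = y.re ∧ x.im = y.im) QuadraticAlgebra.ext_iff.symm

instance (a b : ZMod 2) (n : ℕ)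
    (x y : QuadraticAlgebra (ZMod 2) a b × QuadraticAlgebra (ZMod 2) a b) :
    Decidable (RowRel (ZMod 2) n x y) := by
  cases n <;> unfold RowRel <;> infer_instance

/-- The residue ring of a quadratic polynomial over a field with two elements. -/
noncomputable def quadraticModel (ψ : F ≃+* ZMod 2) (a b : ZMod 2) {f : F[X]}
    (hf : f = X ^ 2 + C (ψ.symm b) * X + C (ψ.symm a)) :
    ResidueModel f (ZMod 2) (QuadraticAlgebra (ZMod 2) a b) :=
  have hlin : ∀ u v : F, eval₂RingHom ((algebraMap (ZMod 2) (QuadraticAlgebra (ZMod 2) a b)).comp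
      ψ.toRingHom) QuadraticAlgebra.omega (C u * X + C v) = ⟨ψ v, ψ u⟩ := by
    intro u v
    ext <;> simp
  { ψ := ψ
    φ := eval₂RingHom ((algebraMap (ZMod 2) (QuadraticAlgebra (ZMod 2) a b)).comp ψ.toRingHom)
      QuadraticAlgebra.omega
    φ_C := fun u => by simp
    ker := by
      intro p
      have hφf : eval₂RingHom ((algebraMap (ZMod 2) (QuadraticAlgebra (ZMod 2) a b)).comp
          ψ.toRingHom) QuadraticAlgebra.omega f = 0 := by
        rw [hf]
        -- The relation is ω² = a + bω; in characteristic two the signs agree and ω is a root of f.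
        ext <;> simp [sq, CharTwo.add_self_eq_zero]
      have hmonic : f.Monic := by
        rw [hf]
        monicity!
      have hdeg : f.natDegree = 2 := by
        rw [hf]
        compute_degree!
      constructor
      · intro h
        rw [← modByMonic_add_div p f, map_add, map_mul, hφf, zero_mul, add_zero] at h
        obtain ⟨u, v, huv⟩ := exists_eq_X_add_C_of_natDegree_le_one (p := p %ₘ f) (by
          have := natDegree_modByMonic_lt p hmonic (by rintro rfl; simp at hdeg)
          omega)
        rw [huv, hlin, QuadraticAlgebra.ext_iff] at h
        simp at h
        rw [← modByMonic_eq_zero_iff_dvd hmonic, huv]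
        simp [h]
      · rintro ⟨g, rfl⟩
        rw [map_mul, hφf, zero_mul]
    surj := fun r => ⟨C (ψ.symm r.im) * X + C (ψ.symm r.re), natDegree_linear_le, by
      rw [hlin]
      simp⟩ }

theorem quadraticModel_φ_X (ψ : F ≃+* ZMod 2) (a b : ZMod 2) {f : F[X]}
    (hf : f = X ^ 2 + C (ψ.symm b) * X + C (ψ.symm a)) :
    (quadraticModel ψ a b hf).φ X = QuadraticAlgebra.omega := by
  simp [quadraticModel]

end Quadratic

/-! ### The four quadratic polynomials over the field with two elements. -/

section Tables

variable {F : Type*} [Field F]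

open QuadraticAlgebra in
theorem isQuotientDiagram_split (ψ : F ≃+* ZMod 2) :
    IsQuotientDiagram (X * (X + 1) : F[X]) diagramSplit
      ![(((t F + 1)⁻¹ : KP F) : OnePoint (KP F)), (((t F)⁻¹ : KP F) : OnePoint (KP F)),
        ((0 : KP F) : OnePoint (KP F)), OnePoint.infty] := by
  have hf : (X * (X + 1) : F[X]) = X ^ 2 + C (ψ.symm 1) * X + C (ψ.symm 0) := by
    simp
    ring
  have hdeg : (X + 1 : F[X]).natDegree = 1 := natDegree_X_add_C 1
  refine (quadraticModel ψ 0 1 hf).isQuotientDiagram _ _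
    ![lower (X + 1), lower X, lower X, weyl F, 1, 1] ![lower (X + 1), lower X, weyl F, 1]
    ![(omega + 1, 1), (omega, 1), (omega, 1), (1, 0), (0, 1), (0, 1)]
    ![(omega + 1, 1), (omega, 1), (1, 0), (0, 1)] omega
    ![fun o => o.elim (Sum.inr 0) fun _ => Sum.inl 1,
      -- The row (ω, 1) leads to (1, ω) for b = 0 and to (ω + 1, ω) for b = 1; at level 1 these are
      -- equivalent to (1, 0) and (ω + 1, 1).
      fun o => o.elim (Sum.inl 2) ![Sum.inl 3, Sum.inl 0],
      fun o => o.elim (Sum.inr 1) fun _ => Sum.inl 1,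
      fun o => o.elim (Sum.inr 2) ![Sum.inl 4, Sum.inl 1],
      fun o => o.elim (Sum.inl 5) fun _ => Sum.inl 3,
      fun o => o.elim (Sum.inr 3) fun _ => Sum.inl 4]
    (quadraticModel_φ_X ..) ?_ ?_ ?_ ?_ ?_ rfl ?_ ?_ ?_ ?_ ?_ ?_ ?_
  · intro i
    fin_cases i <;> simp [ResidueModel.row, quadraticModel_φ_X, lower, weyl]
  · intro c
    fin_cases c <;> simp [ResidueModel.row, quadraticModel_φ_X, lower, weyl]
  · intro c
    fin_cases c <;> rfl
  · decide
  · decide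
  -- Counts, levels, targets and both inequivalence conditions now quantify over finite sets only.
  · decide +kernel
  · decide +kernel
  · decide +kernel
  · decide +kernel
  · decide +kernel
  · have hE : ∀ i j, diagramSplit.m i j ≠ 0 → i = 0 ∧ j = 1 ∨ i = 1 ∧ j = 0 ∨
      i = 2 ∧ j = 1 ∨ i = 1 ∧ j = 2 ∨
      i = 3 ∧ j = 1 ∨ i = 1 ∧ j = 3 ∨
      i = 3 ∧ j = 4 ∨ i = 4 ∧ j = 3 ∨
      i = 5 ∧ j = 4 ∨ i = 4 ∧ j = 5 := by
      decide
    intro i j h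
    rcases hE i j h with
      ⟨rfl, rfl⟩ | ⟨rfl, rfl⟩ | ⟨rfl, rfl⟩ | ⟨rfl, rfl⟩ | ⟨rfl, rfl⟩ | ⟨rfl, rfl⟩ | ⟨rfl, rfl⟩ | ⟨rfl, rfl⟩ | ⟨rfl, rfl⟩ | ⟨rfl, rfl⟩
    · exact (adj_stage_lower_lower (p := (X : F[X])) (q := X + 1) (by simp)).symm
    · exact adj_stage_lower_lower (p := (X : F[X])) (q := X + 1) (by simp)
    · exact (adj_stage_succ (lower X : GL (Fin 2) F[X]) 0).symm
    · exact adj_stage_succ (lower X : GL (Fin 2) F[X]) 0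
    · exact (adj_stage_lower_weyl (p := (X : F[X])) natDegree_X_le).symm
    · exact adj_stage_lower_weyl (p := (X : F[X])) natDegree_X_le
    · exact (adj_stage_one_weyl (F := F)).symm
    · exact adj_stage_one_weyl (F := F)
    · exact (adj_stage_succ (1 : GL (Fin 2) F[X]) 0).symm
    · exact adj_stage_succ (1 : GL (Fin 2) F[X]) 0
  · intro c
    fin_cases c
    · exact hasVisualLimit_lower hdeg (by simp [polyEmb_X]) 1
    · exact hasVisualLimit_lower natDegree_X polyEmb_X 1
    · exact hasVisualLimit_weyl 1
    · exact hasVisualLimit_one 1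

open QuadraticAlgebra in
theorem isQuotientDiagram_square (ψ : F ≃+* ZMod 2) :
    IsQuotientDiagram (X ^ 2 : F[X]) diagramSquare
      ![(((t F)⁻¹ : KP F) : OnePoint (KP F)), ((0 : KP F) : OnePoint (KP F)),
        OnePoint.infty] := by
  have hf : (X ^ 2 : F[X]) = X ^ 2 + C (ψ.symm 0) * X + C (ψ.symm 0) := by
    simp
  refine (quadraticModel ψ 0 0 hf).isQuotientDiagram _ _
    ![lower X, lower X, weyl F, 1, 1] ![lower X, weyl F, 1]
    ![(omega, 1), (omega, 1), (1, 0), (0, 1), (0, 1)]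
    ![(omega, 1), (1, 0), (0, 1)] omega
    ![fun o => o.elim (Sum.inr 0) fun _ => Sum.inl 1,
      -- Here ω² = 0, so 1 and ω + 1 are units, and both rows (1, ω) and (ω + 1, ω) are equivalent
      -- to (1, 0) at level 1.
      fun o => o.elim (Sum.inl 0) fun _ => Sum.inl 2,
      fun o => o.elim (Sum.inr 1) ![Sum.inl 3, Sum.inl 1],
      fun o => o.elim (Sum.inl 4) fun _ => Sum.inl 2,
      fun o => o.elim (Sum.inr 2) fun _ => Sum.inl 3]
    (quadraticModel_φ_X ..) ?_ ?_ ?_ ?_ ?_ rfl ?_ ?_ ?_ ?_ ?_ ?_ ?_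
  · intro i
    fin_cases i <;> simp [ResidueModel.row, quadraticModel_φ_X, lower, weyl]
  · intro c
    fin_cases c <;> simp [ResidueModel.row, quadraticModel_φ_X, lower, weyl]
  · intro c
    fin_cases c <;> rfl
  · decide
  · decide
  · decide +kernel
  · decide +kernel
  · decide +kernel
  · decide +kernel
  · decide +kernel
  · have hE : ∀ i j, diagramSquare.m i j ≠ 0 → i = 0 ∧ j = 1 ∨ i = 1 ∧ j = 0 ∨
      i = 2 ∧ j = 1 ∨ i = 1 ∧ j = 2 ∨
      i = 2 ∧ j = 3 ∨ i = 3 ∧ j = 2 ∨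
      i = 4 ∧ j = 3 ∨ i = 3 ∧ j = 4 := by
      decide
    intro i j h
    rcases hE i j h with
      ⟨rfl, rfl⟩ | ⟨rfl, rfl⟩ | ⟨rfl, rfl⟩ | ⟨rfl, rfl⟩ | ⟨rfl, rfl⟩ | ⟨rfl, rfl⟩ | ⟨rfl, rfl⟩ | ⟨rfl, rfl⟩
    · exact (adj_stage_succ (lower X : GL (Fin 2) F[X]) 0).symm
    · exact adj_stage_succ (lower X : GL (Fin 2) F[X]) 0
    · exact (adj_stage_lower_weyl (p := (X : F[X])) natDegree_X_le).symm
    · exact adj_stage_lower_weyl (p := (X : F[X])) natDegree_X_le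
    · exact (adj_stage_one_weyl (F := F)).symm
    · exact adj_stage_one_weyl (F := F)
    · exact (adj_stage_succ (1 : GL (Fin 2) F[X]) 0).symm
    · exact adj_stage_succ (1 : GL (Fin 2) F[X]) 0
  · intro c
    fin_cases c
    · exact hasVisualLimit_lower natDegree_X polyEmb_X 1
    · exact hasVisualLimit_weyl 1
    · exact hasVisualLimit_one 1

open QuadraticAlgebra in
theorem isQuotientDiagram_square_shift (ψ : F ≃+* ZMod 2) :
    IsQuotientDiagram ((X + 1) ^ 2 : F[X]) diagramSquare
      ![(((t F + 1)⁻¹ : KP F) : OnePoint (KP F)), ((0 : KP F) : OnePoint (KP F)),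
        OnePoint.infty] := by
  have : CharP F 2 := charP_of_injective_ringHom (f := ψ.symm.toRingHom) ψ.symm.injective 2
  have hf : ((X + 1) ^ 2 : F[X]) = X ^ 2 + C (ψ.symm 0) * X + C (ψ.symm 1) := by
    rw [CharTwo.add_sq]
    simp
  have hdeg : (X + 1 : F[X]).natDegree = 1 := natDegree_X_add_C 1
  refine (quadraticModel ψ 1 0 hf).isQuotientDiagram _ _
    ![lower (X + 1), lower (X + 1), weyl F, 1, 1] ![lower (X + 1), weyl F, 1]
    ![(omega + 1, 1), (omega + 1, 1), (1, 0), (0, 1), (0, 1)]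
    ![(omega + 1, 1), (1, 0), (0, 1)] omega
    ![fun o => o.elim (Sum.inr 0) fun _ => Sum.inl 1,
      -- Now ω + 1 is the nilpotent element, and ω takes the role of the second unit.
      fun o => o.elim (Sum.inl 0) fun _ => Sum.inl 2,
      fun o => o.elim (Sum.inr 1) ![Sum.inl 3, Sum.inl 1],
      fun o => o.elim (Sum.inl 4) fun _ => Sum.inl 2,
      fun o => o.elim (Sum.inr 2) fun _ => Sum.inl 3]
    (quadraticModel_φ_X ..) ?_ ?_ ?_ ?_ ?_ rfl ?_ ?_ ?_ ?_ ?_ ?_ ?_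
  · intro i
    fin_cases i <;> simp [ResidueModel.row, quadraticModel_φ_X, lower, weyl]
  · intro c
    fin_cases c <;> simp [ResidueModel.row, quadraticModel_φ_X, lower, weyl]
  · intro c
    fin_cases c <;> rfl
  · decide
  · decide
  · decide +kernel
  · decide +kernel
  · decide +kernel
  · decide +kernel
  · decide +kernel
  · have hE : ∀ i j, diagramSquare.m i j ≠ 0 → i = 0 ∧ j = 1 ∨ i = 1 ∧ j = 0 ∨
      i = 2 ∧ j = 1 ∨ i = 1 ∧ j = 2 ∨
      i = 2 ∧ j = 3 ∨ i = 3 ∧ j = 2 ∨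
      i = 4 ∧ j = 3 ∨ i = 3 ∧ j = 4 := by
      decide
    intro i j h
    rcases hE i j h with
      ⟨rfl, rfl⟩ | ⟨rfl, rfl⟩ | ⟨rfl, rfl⟩ | ⟨rfl, rfl⟩ | ⟨rfl, rfl⟩ | ⟨rfl, rfl⟩ | ⟨rfl, rfl⟩ | ⟨rfl, rfl⟩
    · exact (adj_stage_succ (lower (X + 1) : GL (Fin 2) F[X]) 0).symm
    · exact adj_stage_succ (lower (X + 1) : GL (Fin 2) F[X]) 0
    · exact (adj_stage_lower_weyl (p := (X + 1 : F[X])) hdeg.le).symm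
    · exact adj_stage_lower_weyl (p := (X + 1 : F[X])) hdeg.le
    · exact (adj_stage_one_weyl (F := F)).symm
    · exact adj_stage_one_weyl (F := F)
    · exact (adj_stage_succ (1 : GL (Fin 2) F[X]) 0).symm
    · exact adj_stage_succ (1 : GL (Fin 2) F[X]) 0
  · intro c
    fin_cases c
    · exact hasVisualLimit_lower hdeg (by simp [polyEmb_X]) 1
    · exact hasVisualLimit_weyl 1
    · exact hasVisualLimit_one 1

open QuadraticAlgebra in
theorem isQuotientDiagram_inert (ψ : F ≃+* ZMod 2) :
    IsQuotientDiagram (X ^ 2 + X + 1 : F[X]) diagramInert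
      ![((0 : KP F) : OnePoint (KP F)), OnePoint.infty] := by
  have hf : (X ^ 2 + X + 1 : F[X]) = X ^ 2 + C (ψ.symm 1) * X + C (ψ.symm 1) := by
    simp
  refine (quadraticModel ψ 1 1 hf).isQuotientDiagram _ _
    ![lower X, weyl F, 1, 1] ![weyl F, 1]
    ![(omega, 1), (1, 0), (0, 1), (0, 1)]
    ![(1, 0), (0, 1)] omega
    -- The residue ring is a field, so the nonzero first entries ω, 1 and ω + 1 of the three
    -- neighboring rows are units, and all three rows are equivalent to (1, 0).
    ![fun _ => Sum.inl 1,
      fun o => o.elim (Sum.inr 0) ![Sum.inl 2, Sum.inl 0],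
      fun o => o.elim (Sum.inl 3) fun _ => Sum.inl 1,
      fun o => o.elim (Sum.inr 1) fun _ => Sum.inl 2]
    (quadraticModel_φ_X ..) ?_ ?_ ?_ ?_ ?_ rfl ?_ ?_ ?_ ?_ ?_ ?_ ?_
  · intro i
    fin_cases i <;> simp [ResidueModel.row, quadraticModel_φ_X, lower, weyl]
  · intro c
    fin_cases c <;> simp [ResidueModel.row, weyl]
  · intro c
    fin_cases c <;> rfl
  · decide
  · decide
  · decide +kernel
  · decide +kernel
  · decide +kernel
  · decide +kernel
  · decide +kernel
  · have hE : ∀ i j, diagramInert.m i j ≠ 0 → i = 1 ∧ j = 0 ∨ i = 0 ∧ j = 1 ∨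
      i = 1 ∧ j = 2 ∨ i = 2 ∧ j = 1 ∨
      i = 3 ∧ j = 2 ∨ i = 2 ∧ j = 3 := by
      decide
    intro i j h
    rcases hE i j h with
      ⟨rfl, rfl⟩ | ⟨rfl, rfl⟩ | ⟨rfl, rfl⟩ | ⟨rfl, rfl⟩ | ⟨rfl, rfl⟩ | ⟨rfl, rfl⟩
    · exact (adj_stage_lower_weyl (p := (X : F[X])) natDegree_X_le).symm
    · exact adj_stage_lower_weyl (p := (X : F[X])) natDegree_X_le
    · exact (adj_stage_one_weyl (F := F)).symm
    · exact adj_stage_one_weyl (F := F)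
    · exact (adj_stage_succ (1 : GL (Fin 2) F[X]) 0).symm
    · exact adj_stage_succ (1 : GL (Fin 2) F[X]) 0
  · intro c
    fin_cases c
    · exact hasVisualLimit_weyl 1
    · exact hasVisualLimit_one 1

end Tables

end BruhatTits

open BruhatTits in
theorem propositionp52 {F : Type*} [Field F] [Fintype F] :
    IsQuotientDiagram (X : F[X]) (diagramLinear (Fintype.card F) Fintype.card_ne_zero)
      ![((0 : KP F) : OnePoint (KP F)), OnePoint.infty] ∧
    (Fintype.card F = 2 →
      IsQuotientDiagram (X * (X + 1) : F[X]) diagramSplit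
        ![(((t F + 1)⁻¹ : KP F) : OnePoint (KP F)), (((t F)⁻¹ : KP F) : OnePoint (KP F)),
          ((0 : KP F) : OnePoint (KP F)), OnePoint.infty] ∧
      IsQuotientDiagram (X ^ 2 : F[X]) diagramSquare
        ![(((t F)⁻¹ : KP F) : OnePoint (KP F)), ((0 : KP F) : OnePoint (KP F)),
          OnePoint.infty] ∧
      IsQuotientDiagram ((X + 1) ^ 2 : F[X]) diagramSquare
        ![(((t F + 1)⁻¹ : KP F) : OnePoint (KP F)), ((0 : KP F) : OnePoint (KP F)),
          OnePoint.infty] ∧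
      IsQuotientDiagram (X ^ 2 + X + 1 : F[X]) diagramInert
        ![((0 : KP F) : OnePoint (KP F)), OnePoint.infty]) := by
  refine ⟨isQuotientDiagram_linear, fun hF => ?_⟩
  let ψ : F ≃+* ZMod 2 := (ZMod.ringEquivOfPrime F Nat.prime_two hF).symm
  exact ⟨isQuotientDiagram_split ψ, isQuotientDiagram_square ψ, isQuotientDiagram_square_shift ψ,
    isQuotientDiagram_inert ψ⟩
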